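/- **Notation.** Let $n\ge 2$ and $1\le m\le n$ be integers and $p\in(0,1/20)$. Let $\|\cdot\|$ be the Euclidean norm on $\mathbb R^n$ and $S^{n-1}$ the unit sphere. For $x\in\mathbb R^n$ let $x_1^*\ge x_2^*\ge\dots\ge x_n^*$ be the non-increasing rearrangement of $(|x_i|)_{i\le n}$, and let $Qx$ be the vector obtained from $x$ by replacing one coordinate of largest absolute value by $0$. For $\gamma>0$ let $$U(m,\gamma)=\Big\{x\in\mathbb R^n:\ \exists A\subset\{1,\dots,n\},\ |A|=n-m,\ \exists\lambda\in\mathbb R,\ |\lambda|\le \tfrac{2}{\sqrt m},\ \forall i\in A:\ |x_i-\lambda|\le\tfrac{\gamma}{\sqrt n}\Big\}.$$ Let $C_0\ge 1$ and $c_0>0$ be constants and put $\beta_p=\sqrt p/C_0$. For $0<a<1$ let the *ladder* from $a$ be the finite sequence $t_1<\dots<t_\ell$ with $t_1=a$, $t_{k+1}=3t_k$ for $k<\ell-1$, $1/3\le t_{\ell-1}<1$ and $t_\ell=1$. Let $(\lambda_k)_{k\le\ell}$ be the ladder from $\frac1{6pn}$ and $(\mu_k)_{k\le s}$ the ladder from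 $\frac{\beta_p}{6pn}$ (defined when $6pn>1$). Put $$\mathcal B_1=\{x\in S^{n-1}: x_1^*>6pn\,x_2^*\},\qquad \mathcal B_2'=\{x\in S^{n-1}: x\notin\mathcal B_1,\ x_1^*\le\beta_p\},\qquad \mathcal B_2=\mathcal B_2'\cap U(m,c_0),$$ $$\mathcal B_3=\bigcup_{k=1}^{\ell-1}\Big\{x\in S^{n-1}: x\notin\mathcal B_1\cup\mathcal B_2',\ x_2^*\le\beta_p\|Qx\|,\ \lambda_k\le\|Qx\|<\lambda_{k+1}\Big\}\cap U(m,c_0\lambda_k),$$ $$\mathcal B_4=\bigcup_{k=1}^{s-1}\Big\{x\in S^{n-1}: x\notin\mathcal B_1\cup\mathcal B_2',\ x_2^*>\beta_p\|Qx\|,\ \mu_k\le x_2^*<\mu_{k+1}\Big\}\cap U\Big(m,\frac{c_0\mu_k}{\sqrt{\ln(e/p)}}\Big),$$ and $\mathcal B(p,m)=\mathcal B_1\cup\mathcal B_2\cup\mathcal B_3\cup\mathcal B_4$. This set depends also on $n$, $C_0$ and $c_0$. **Theorem.** There is an absolute constant $C_*\ge1$ such that for every $C_0\ge C_*$ there are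 $c_*,c,C>0$ and $N\in\mathbb N$, depending only on $C_0$, such that the following holds for every $0<c_0\le c_*$. Let $n\ge N$, $\frac{30\ln n}{n}\le p<\frac1{20}$, and let $1\le m\le n$ be an integer with $m\le \frac{cpn}{\ln(e/p)}$. Let $M$ be an $n\times n$ random matrix with independent entries, each equal to $1$ with probability $p$ and to $0$ with probability $1-p$. Then $$\mathbb P\Big\{\exists x\in\mathcal B(p,m)\ \text{ such that }\ \|Mx\|<\frac{1}{C\sqrt{n\ln(e/p)}}\,\|x\|\Big\}\le n(1-p)^n+4e^{-1.5np}.$$ -/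

import Mathlib

open MeasureTheory ProbabilityTheory

noncomputable section

namespace SteepVectors

/-- `M` is an `n × n` Bernoulli(`p`) random matrix on `(Ω, μ)`: its entries are jointly
independent, each equal to `1` with probability `p` and to `0` with probability `1 - p`. -/
structure IsBernoulliMatrix {Ω : Type*} [MeasurableSpace Ω] (μ : Measure Ω) {n : ℕ}
    (p : unitInterval) (M : Ω → Matrix (Fin n) (Fin n) ℝ) : Prop where
  hasLaw : ∀ i j, HasLaw (fun ω => M ω i j) (bernoulliMeasure (1 : ℝ) 0 p) μ
  indep : iIndepFun (fun (ij : Fin n × Fin n) ω => M ω ij.1 ij.2) μ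

/-- A permutation `σ_x` for which `i ↦ |x (σ_x i)|` is non-increasing
(ties are broken by the order of the indices). -/
def sortPerm {n : ℕ} (x : EuclideanSpace ℝ (Fin n)) : Equiv.Perm (Fin n) :=
  Tuple.sort fun i => -|x i|

theorem antitone_abs_sortPerm {n : ℕ} (x : EuclideanSpace ℝ (Fin n)) :
    Antitone fun i => |x (sortPerm x i)| := fun _ _ hij =>
  neg_le_neg_iff.mp (Tuple.monotone_sort (fun i => -|x i|) hij)

/-- `star x k` is `x_k^*`, the `k`-th term (`1 ≤ k ≤ n`) of the non-increasing rearrangement of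
the absolute values of the coordinates of `x`. The value is `0` for `k` outside this range. -/
def star {n : ℕ} (x : EuclideanSpace ℝ (Fin n)) (k : ℕ) : ℝ :=
  if h : 1 ≤ k ∧ k ≤ n then |x (sortPerm x ⟨k - 1, by omega⟩)| else 0

/-- The nonlinear operator `Q`, which replaces the coordinate of `x` with index `σ_x(1)`
(a coordinate of largest absolute value) by `0` and keeps the other coordinates. -/
def Q {n : ℕ} (x : EuclideanSpace ℝ (Fin n)) : EuclideanSpace ℝ (Fin n) :=
  WithLp.toLp 2 fun i => if ((sortPerm x).symm i : ℕ) = 0 then 0 else x i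

/-- The shifted sparse vectors `U(m, γ)` in `ℝⁿ`. -/
def U (n m : ℕ) (γ : ℝ) : Set (EuclideanSpace ℝ (Fin n)) :=
  {x | ∃ A : Finset (Fin n), A.card = n - m ∧ ∃ lam : ℝ, |lam| ≤ 2 / Real.sqrt m ∧
    ∀ i ∈ A, |x i - lam| ≤ γ / Real.sqrt n}

/-- The geometric ladder with ratio `3` which starts at `a` and is cut at `1`:
`ladder a 1 = a`, `ladder a (k + 1) = 3 * ladder a k` as long as the result is below `1`,
and all later terms are `1`. -/
def ladder (a : ℝ) (k : ℕ) : ℝ := min (3 ^ (k - 1) * a) 1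

/-- `β_p = √p / C₀`. -/
def beta (C₀ p : ℝ) : ℝ := Real.sqrt p / C₀

/-- Unit vectors with one coordinate much larger than all others. -/
def B₁ (n : ℕ) (p : ℝ) : Set (EuclideanSpace ℝ (Fin n)) :=
  {x | ‖x‖ = 1 ∧ star x 1 > 6 * p * n * star x 2}

/-- The set `B₂'`. -/
def B₂' (C₀ : ℝ) (n : ℕ) (p : ℝ) : Set (EuclideanSpace ℝ (Fin n)) :=
  {x | ‖x‖ = 1 ∧ x ∉ B₁ n p ∧ star x 1 ≤ beta C₀ p}

def B₂ (C₀ c₀ : ℝ) (n : ℕ) (p : ℝ) (m : ℕ) : Set (EuclideanSpace ℝ (Fin n)) :=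
  B₂' C₀ n p ∩ U n m c₀

/-- `λ_k`: the ladder which starts at `1 / (6pn)`. -/
def lam (n : ℕ) (p : ℝ) (k : ℕ) : ℝ := ladder (1 / (6 * p * n)) k

/-- `μ_k`: the ladder which starts at `β_p / (6pn)`. -/
def mu (C₀ : ℝ) (n : ℕ) (p : ℝ) (k : ℕ) : ℝ := ladder (beta C₀ p / (6 * p * n)) k

def B₃k (C₀ c₀ : ℝ) (n : ℕ) (p : ℝ) (m k : ℕ) : Set (EuclideanSpace ℝ (Fin n)) :=
  {x | ‖x‖ = 1 ∧ x ∉ B₁ n p ∪ B₂' C₀ n p ∧ star x 2 ≤ beta C₀ p * ‖Q x‖ ∧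
    lam n p k ≤ ‖Q x‖ ∧ ‖Q x‖ < lam n p (k + 1)} ∩ U n m (c₀ * lam n p k)

/-- The union of `B₃k` over all rungs `λ_k` of the ladder below the top value `1`. -/
def B₃ (C₀ c₀ : ℝ) (n : ℕ) (p : ℝ) (m : ℕ) : Set (EuclideanSpace ℝ (Fin n)) :=
  {x | ∃ k : ℕ, 1 ≤ k ∧ lam n p k < 1 ∧ x ∈ B₃k C₀ c₀ n p m k}

def B₄k (C₀ c₀ : ℝ) (n : ℕ) (p : ℝ) (m k : ℕ) : Set (EuclideanSpace ℝ (Fin n)) :=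
  {x | ‖x‖ = 1 ∧ x ∉ B₁ n p ∪ B₂' C₀ n p ∧ star x 2 > beta C₀ p * ‖Q x‖ ∧
    mu C₀ n p k ≤ star x 2 ∧ star x 2 < mu C₀ n p (k + 1)} ∩
  U n m (c₀ * mu C₀ n p k / Real.sqrt (Real.log (Real.exp 1 / p)))

/-- The union of `B₄k` over all rungs `μ_k` of the ladder below the top value `1`. -/
def B₄ (C₀ c₀ : ℝ) (n : ℕ) (p : ℝ) (m : ℕ) : Set (EuclideanSpace ℝ (Fin n)) :=
  {x | ∃ k : ℕ, 1 ≤ k ∧ mu C₀ n p k < 1 ∧ x ∈ B₄k C₀ c₀ n p m k}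

/-- The class `B(p, m)` of structured unit vectors in `ℝⁿ`. -/
def B (C₀ c₀ : ℝ) (n : ℕ) (p : ℝ) (m : ℕ) : Set (EuclideanSpace ℝ (Fin n)) :=
  B₁ n p ∪ B₂ C₀ c₀ n p m ∪ B₃ C₀ c₀ n p m ∪ B₄ C₀ c₀ n p m

end SteepVectors

end

/-! Only finitely many `0/1` matrices matter, so the law of `M` is replaced by the finite product
weight `matP` (`IsBernoulliMatrix.measureReal_le`). Outside three events (a zero column, a row with
more than `5pn` ones, and, for rows without such excess, a sign vector with large centered image)
the classes are treated as follows.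

For a vector of `B₁`, choose a row with a one in the column of the dominant coordinate. The other
ones of that row contribute at most `5pn x₂* < (5/6) x₁*`, so this entry of the image alone is at
least `x₁*/6 ≥ 1/(6√n)` (`norm_mv_ge_of_mem_B₁`).

The other classes split into levels `γ`: `1` for `B₂`, `λ_k` for `B₃`, `μ_k` for `B₄`. A fixed
vector of level `γ` satisfies `‖Mx‖ ≤ γ√(pn)/40` with probability at most `e^{-1.85pn}`. If its mass
is spread, as in `B₂` and `B₃`, this comes from the characteristic function of a row
(`rowE_exp_neg_sq_le_of_flat`). In `B₄` it comes from two coordinates of size at least `γ`: a row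
hits exactly one of them with probability about `2p` (`rowE_exp_neg_sq_le_of_two_large`). Laplace
transforms multiply over the rows.

A net makes this uniform. Since `M = (M - p) + p·11ᵀ`, and the first part is bounded on the cube by
its values on sign vectors (`norm_centered_le`), two vectors have nearby images once they are close
in sup norm and have nearby coordinate sums (`norm_mv_le`). Cells therefore record a flat set of `n
- m` coordinates, a few rounded numbers including the sum, and a rounded vector on the remaining
coordinates. The `ℓ₁`-norm of that vector is controlled by Cauchy–Schwarz. For `m ≤ cpn/ln(e/p)`
there are at most `e^{0.05pn}` times a power of `n` cells (`card_cellKeys_le`, `net_entropy_le`).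
All polynomial factors, including the number of levels, are absorbed because `pn ≥ 30 ln n` makes
`e^{0.3pn} ≥ n⁹`. The argument gives the threshold `1/(480 C₀ √n)`, which is at least the one
required. -/

namespace SteepVectors

/-! ### Finite Bernoulli products -/

/-- The real number `0` or `1` attached to a Boolean. -/
def bv (b : Bool) : ℝ := if b then 1 else 0

/-- The mass of a Boolean under the Bernoulli(`p`) law. -/
def bw (p : ℝ) (b : Bool) : ℝ := if b then p else 1 - p

/-- Expectation over a vector of independent Bernoulli(`p`) variables. -/
noncomputable def rowE {ι : Type*} [Fintype ι] [DecidableEq ι] (p : ℝ) (f : (ι → Bool) → ℝ) : ℝ :=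
  ∑ r, (∏ j, bw p (r j)) * f r

/-- Probability of a set of `0/1` matrices with independent Bernoulli(`p`) entries. -/
noncomputable def matP {n : ℕ} (p : ℝ) (S : Set (Fin n → Fin n → Bool)) : ℝ :=
  ∑ b : Fin n → Fin n → Bool, (∏ i, ∏ j, bw p (b i j)) * S.indicator 1 b

theorem bw_nonneg {p : ℝ} (h0 : 0 ≤ p) (h1 : p ≤ 1) (b : Bool) : 0 ≤ bw p b := by
  unfold bw; split_ifs <;> linarith

section Row

variable {ι : Type*} [Fintype ι] [DecidableEq ι] {p : ℝ}

theorem rowE_mono (h0 : 0 ≤ p) (h1 : p ≤ 1) {f g : (ι → Bool) → ℝ} (h : ∀ r, f r ≤ g r) :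
    rowE p f ≤ rowE p g :=
  Finset.sum_le_sum fun r _ => mul_le_mul_of_nonneg_left (h r)
    (Finset.prod_nonneg fun _ _ => bw_nonneg h0 h1 _)

theorem rowE_nonneg (h0 : 0 ≤ p) (h1 : p ≤ 1) {f : (ι → Bool) → ℝ} (h : ∀ r, 0 ≤ f r) :
    0 ≤ rowE p f :=
  Finset.sum_nonneg fun r _ => mul_nonneg (Finset.prod_nonneg fun _ _ => bw_nonneg h0 h1 _) (h r)

theorem rowE_add (f g : (ι → Bool) → ℝ) : rowE p (fun r => f r + g r) = rowE p f + rowE p g := by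
  simp [rowE, mul_add, Finset.sum_add_distrib]

theorem rowE_const_mul (c : ℝ) (f : (ι → Bool) → ℝ) :
    rowE p (fun r => c * f r) = c * rowE p f := by
  simp only [rowE, Finset.mul_sum]; exact Finset.sum_congr rfl fun r _ => by ring

theorem rowE_sum {κ : Type*} (s : Finset κ) (f : κ → (ι → Bool) → ℝ) :
    rowE p (fun r => ∑ k ∈ s, f k r) = ∑ k ∈ s, rowE p (f k) := by
  simp only [rowE, Finset.mul_sum]; exact Finset.sum_comm

theorem sum_prod_bool {R : Type*} [CommSemiring R] (g : ι → Bool → R) :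
    ∑ r : ι → Bool, ∏ j, g j (r j) = ∏ j, (g j true + g j false) := by
  have := Finset.prod_univ_sum (fun _ : ι => (Finset.univ : Finset Bool)) g
  simp only [Fintype.piFinset_univ] at this
  rw [← this]; simp

theorem rowE_prod (g : ι → Bool → ℝ) :
    rowE p (fun r => ∏ j, g j (r j)) = ∏ j, (p * g j true + (1 - p) * g j false) := by
  simp only [rowE, ← Finset.prod_mul_distrib]
  rw [sum_prod_bool (fun j b => bw p b * g j b)]; simp [bw]

theorem rowE_const (c : ℝ) : rowE (ι := ι) p (fun _ => c) = c := by
  have := rowE_prod (ι := ι) (p := p) (fun _ _ => 1)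
  have h2 := rowE_const_mul (ι := ι) (p := p) c (fun _ => 1)
  simp only [Finset.prod_const_one, mul_one] at this h2
  rw [h2, this]; simp

/-- Averaging over one coordinate does not change the expectation. -/
theorem rowE_resample (j : ι) (f : (ι → Bool) → ℝ) :
    rowE p f = rowE p (fun r =>
      p * f (Function.update r j true) + (1 - p) * f (Function.update r j false)) := by
  have key : ∀ g : (ι → Bool) → ℝ, ∑ r, g r =
      ∑ s : ({i // i ≠ j} → Bool), (g ((Equiv.funSplitAt j Bool).symm (true, s)) +
        g ((Equiv.funSplitAt j Bool).symm (false, s))) := by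
    intro g
    rw [← Equiv.sum_comp (Equiv.funSplitAt j Bool).symm, Fintype.sum_prod_type, Fintype.sum_bool,
      Finset.sum_add_distrib]
  have hu : ∀ (b c : Bool) (s : {i // i ≠ j} → Bool),
      Function.update ((Equiv.funSplitAt j Bool).symm (b, s)) j c =
        (Equiv.funSplitAt j Bool).symm (c, s) := by
    intro b c s; ext i
    by_cases h : i = j
    · subst h; simp [Equiv.funSplitAt, Equiv.piSplitAt]
    · simp [Equiv.funSplitAt, Equiv.piSplitAt, h]
  have hw : ∀ (b : Bool) (s : {i // i ≠ j} → Bool),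
      ∏ i, bw p ((Equiv.funSplitAt j Bool).symm (b, s) i) = bw p b * ∏ i, bw p (s i) := by
    intro b s
    rw [Fintype.prod_eq_mul_prod_subtype_ne _ j]
    congr 1
    · simp [Equiv.funSplitAt, Equiv.piSplitAt]
    · exact Finset.prod_congr rfl fun i _ => by simp [Equiv.funSplitAt, Equiv.piSplitAt, i.2]
  simp only [rowE]
  rw [key, key]
  refine Finset.sum_congr rfl fun s _ => ?_
  simp only [hu, hw]
  simp only [bw]; simp; ring

end Row

section Mat

variable {n : ℕ} {p : ℝ}

theorem matW_nonneg (h0 : 0 ≤ p) (h1 : p ≤ 1) (b : Fin n → Fin n → Bool) :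
    0 ≤ ∏ i, ∏ j, bw p (b i j) :=
  Finset.prod_nonneg fun _ _ => Finset.prod_nonneg fun _ _ => bw_nonneg h0 h1 _

theorem matP_mono (h0 : 0 ≤ p) (h1 : p ≤ 1) {S T : Set (Fin n → Fin n → Bool)} (h : S ⊆ T) :
    matP p S ≤ matP p T :=
  Finset.sum_le_sum fun b _ => mul_le_mul_of_nonneg_left
    (Set.indicator_le_indicator_of_subset h (fun _ => zero_le_one) b) (matW_nonneg h0 h1 b)

theorem matP_union_le (h0 : 0 ≤ p) (h1 : p ≤ 1) (S T : Set (Fin n → Fin n → Bool)) :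
    matP p (S ∪ T) ≤ matP p S + matP p T := by
  simp only [matP, ← Finset.sum_add_distrib, ← mul_add]
  refine Finset.sum_le_sum fun b _ => mul_le_mul_of_nonneg_left ?_ (matW_nonneg h0 h1 b)
  by_cases hS : b ∈ S <;> by_cases hT : b ∈ T <;> simp [hS, hT]

theorem matP_biUnion_le (h0 : 0 ≤ p) (h1 : p ≤ 1) {κ : Type*} (s : Finset κ)
    (S : κ → Set (Fin n → Fin n → Bool)) {a : ℝ} (h : ∀ k ∈ s, matP p (S k) ≤ a) :
    matP p (⋃ k ∈ s, S k) ≤ s.card * a := by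
  classical
  induction s using Finset.induction_on with
  | empty => simp [matP]
  | insert k s hk ih =>
    rw [Finset.set_biUnion_insert, Finset.card_insert_of_notMem hk]
    have h1' := matP_union_le h0 h1 (S k) (⋃ k ∈ s, S k)
    have h2 := ih fun k hk => h k (Finset.mem_insert_of_mem hk)
    have h3 := h k (Finset.mem_insert_self _ _)
    push_cast; linarith

/-- Markov's inequality for a product of functions of the rows. -/
theorem mul_matP_le (h0 : 0 ≤ p) (h1 : p ≤ 1) {S : Set (Fin n → Fin n → Bool)}
    (F : Fin n → (Fin n → Bool) → ℝ) (hF : ∀ i r, 0 ≤ F i r) (a : ℝ)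
    (hS : ∀ b ∈ S, a ≤ ∏ i, F i (b i)) : a * matP p S ≤ ∏ i, rowE p (F i) := by
  have : ∏ i, rowE p (F i) =
      ∑ b : Fin n → Fin n → Bool, (∏ i, ∏ j, bw p (b i j)) * ∏ i, F i (b i) := by
    have := Finset.prod_univ_sum (fun _ : Fin n => (Finset.univ : Finset (Fin n → Bool)))
      (fun i r => (∏ j, bw p (r j)) * F i r)
    simp only [Fintype.piFinset_univ] at this
    simp only [rowE, this, Finset.prod_mul_distrib]
  rw [this, matP, Finset.mul_sum]
  refine Finset.sum_le_sum fun b _ => ?_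
  by_cases hb : b ∈ S
  · simp only [hb, Set.indicator_of_mem, Pi.one_apply, mul_one]
    rw [mul_comm]
    exact mul_le_mul_of_nonneg_left (hS b hb) (matW_nonneg h0 h1 b)
  · simp only [hb, not_false_eq_true, Set.indicator_of_notMem, mul_zero]
    exact mul_nonneg (matW_nonneg h0 h1 b) (Finset.prod_nonneg fun i _ => hF i _)

/-- The law of a Bernoulli matrix is given by the finite product weights. -/
theorem IsBernoulliMatrix.measureReal_le {Ω : Type*} [MeasurableSpace Ω] {μ : Measure Ω}
    [IsProbabilityMeasure μ] {p : unitInterval} {M : Ω → Matrix (Fin n) (Fin n) ℝ}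
    (hM : IsBernoulliMatrix μ p M) (T : Matrix (Fin n) (Fin n) ℝ → Prop) :
    μ.real {ω | T (M ω)} ≤ matP (p : ℝ) {b | T (Matrix.of fun i j => bv (b i j))} := by
  classical
  set V : (Fin n → Fin n → Bool) → Set Ω := fun b => {ω | ∀ i j, M ω i j = bv (b i j)}
  have hV : ∀ b, μ.real (V b) = ∏ i, ∏ j, bw (p : ℝ) (b i j) := by
    intro b
    have h := hM.indep.measure_inter_preimage_eq_mul Finset.univ
      (sets := fun ij => {bv (b ij.1 ij.2)}) (fun _ _ => measurableSet_singleton _)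
    have e : V b = ⋂ ij ∈ (Finset.univ : Finset (Fin n × Fin n)),
        (fun ω => M ω ij.1 ij.2) ⁻¹' {bv (b ij.1 ij.2)} := by
      ext ω; simp [V]
    rw [measureReal_def, e, h, ENNReal.toReal_prod, Fintype.prod_prod_type]
    refine Finset.prod_congr rfl fun i _ => Finset.prod_congr rfl fun j _ => ?_
    have hm : MeasurableSet {x : ℝ | x = bv (b i j)} := measurableSet_singleton _
    have := (hM.hasLaw i j).measureReal_eq (p := fun x => x = bv (b i j)) hm
    rw [measureReal_def] at this
    refine this.trans ?_
    rw [bernoulliMeasure_real_apply _ hm]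
    cases b i j <;> simp [bv, bw]
  -- Outside this null set every entry is `0` or `1`. As `T` carries no measurability, the event is
  -- only covered by `N` and finitely many `V b`, which suffices for an upper bound.
  set N : Set Ω := ⋃ i, ⋃ j, {ω | ¬ (M ω i j = 1 ∨ M ω i j = 0)}
  have hN : μ N = 0 := by
    refine measure_iUnion_null fun i => measure_iUnion_null fun j => ?_
    have hm : MeasurableSet {x : ℝ | ¬ (x = 1 ∨ x = 0)} :=
      ((measurableSet_singleton _).union (measurableSet_singleton _)).compl
    refine ((hM.hasLaw i j).measure_eq (p := fun x => ¬ (x = 1 ∨ x = 0)) hm).trans ?_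
    rw [bernoulliMeasure_apply _ hm]; simp
  set S : Set (Fin n → Fin n → Bool) := {b | T (Matrix.of fun i j => bv (b i j))}
  have hsub : {ω | T (M ω)} ⊆ N ∪ ⋃ b ∈ Finset.univ.filter (· ∈ S), V b := by
    intro ω hω
    by_cases hn : ω ∈ N
    · exact Or.inl hn
    · right
      simp only [N, Set.mem_iUnion, Set.mem_ofPred_eq, not_exists, not_not] at hn
      have e : ∀ i j, M ω i j = bv (decide (M ω i j = 1)) := by
        intro i j; rcases hn i j with h | h <;> simp [h, bv]
      simp only [Set.mem_iUnion]
      refine ⟨fun i j => decide (M ω i j = 1), ?_, e⟩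
      simp only [Finset.mem_filter, Finset.mem_univ, true_and, S, Set.mem_ofPred_eq]
      have hm : (Matrix.of fun i j => bv (decide (M ω i j = 1))) = M ω := by
        ext i j; exact (e i j).symm
      rw [hm]; exact hω
  calc μ.real {ω | T (M ω)} ≤ μ.real (N ∪ ⋃ b ∈ Finset.univ.filter (· ∈ S), V b) :=
        measureReal_mono hsub
    _ ≤ μ.real N + μ.real (⋃ b ∈ Finset.univ.filter (· ∈ S), V b) := measureReal_union_le _ _
    _ ≤ 0 + ∑ b ∈ Finset.univ.filter (· ∈ S), μ.real (V b) := by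
        gcongr
        · rw [measureReal_def, hN]; simp
        · exact measureReal_biUnion_finset_le _ _
    _ = matP (p : ℝ) S := by
        rw [zero_add, matP, Finset.sum_filter]
        refine Finset.sum_congr rfl fun b _ => ?_
        by_cases hb : b ∈ S <;> simp [hb, hV]

end Mat

/-! ### Estimates for a single row -/

/-- The scalar product of a `0/1` row with a vector. -/
noncomputable def dot {ι : Type*} [Fintype ι] (r : ι → Bool) (x : ι → ℝ) : ℝ := ∑ j, bv (r j) * x j

section Row

variable {ι : Type*} [Fintype ι] [DecidableEq ι] {p : ℝ}

/-! ### Exponential moments of a row. -/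

theorem exp_le_one_add_add_sq {u : ℝ} (hu : |u| ≤ 1) : Real.exp u ≤ 1 + u + u ^ 2 := by
  have := Real.abs_exp_sub_one_sub_id_le hu
  have := (abs_le.mp this).2
  linarith

/-- The expectation factors over coordinates, and `p e^y + 1 - p ≤ e^{py + py²}` for `|y| ≤ 1`; the
centering cancels the linear term. -/
theorem rowE_exp_centered_le (h0 : 0 ≤ p) (h1 : p ≤ 1) (y : ι → ℝ) (hy : ∀ j, |y j| ≤ 1) :
    rowE p (fun r => Real.exp (∑ j, (bv (r j) - p) * y j)) ≤ Real.exp (p * ∑ j, y j ^ 2) := by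
  simp only [Real.exp_sum, Finset.mul_sum]
  rw [rowE_prod (fun j b => Real.exp ((bv b - p) * y j))]
  refine Finset.prod_le_prod (fun j _ => ?_) fun j _ => ?_
  · have : 0 ≤ 1 - p := by linarith
    positivity
  · simp only [bv, if_true, Bool.false_eq_true, if_false]
    have e1 : Real.exp ((1 - p) * y j) = Real.exp (-(p * y j)) * Real.exp (y j) := by
      rw [← Real.exp_add]; ring_nf
    have e2 : (0 - p) * y j = -(p * y j) := by ring
    rw [e1, e2]
    have h3 := exp_le_one_add_add_sq (hy j)
    have h4 : p * Real.exp (y j) + (1 - p) ≤ Real.exp (p * y j + p * y j ^ 2) := by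
      have := Real.add_one_le_exp (p * y j + p * y j ^ 2)
      nlinarith
    calc p * (Real.exp (-(p * y j)) * Real.exp (y j)) + (1 - p) * Real.exp (-(p * y j))
        = Real.exp (-(p * y j)) * (p * Real.exp (y j) + (1 - p)) := by ring
      _ ≤ Real.exp (-(p * y j)) * Real.exp (p * y j + p * y j ^ 2) := by gcongr
      _ = Real.exp (p * y j ^ 2) := by rw [← Real.exp_add]; ring_nf

theorem rowE_exp_rowSum_le (h0 : 0 ≤ p) (h1 : p ≤ 1) :
    rowE p (fun r : ι → Bool => Real.exp (∑ j, bv (r j))) ≤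
      Real.exp (2 * p * Fintype.card ι) := by
  have h := rowE_exp_centered_le (ι := ι) h0 h1 (fun _ => 1) (by simp)
  have e : (fun r : ι → Bool => Real.exp (∑ j, bv (r j))) =
      fun r => Real.exp (p * Fintype.card ι) * Real.exp (∑ j, (bv (r j) - p) * 1) := by
    funext r; rw [← Real.exp_add]; congr 1
    simp [Finset.sum_sub_distrib, mul_comm]
  rw [e, rowE_const_mul]
  refine (mul_le_mul_of_nonneg_left h (Real.exp_pos _).le).trans_eq ?_
  rw [← Real.exp_add]; congr 1; simp; ring

/-- A discrete Gaussian linearization: the single term `k = ⌊v⌋` already dominates. It turns a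
squared exponential moment into ordinary exponential moments. -/
theorem exp_sq_le_sum_exp {v : ℝ} {K : ℕ} (hv : 0 ≤ v) (hK : v < K) :
    Real.exp (v ^ 2 / 72) ≤ Real.exp (1 / 36) *
      ∑ k ∈ Finset.range K, Real.exp (-(k : ℝ) ^ 2 / 72) * Real.exp (k * v / 12) := by
  have hk : ⌊v⌋₊ ∈ Finset.range K := by
    rw [Finset.mem_range]; exact (Nat.floor_lt hv).2 hK
  have h1 := Finset.single_le_sum (s := Finset.range K)
    (f := fun k : ℕ => Real.exp (-(k : ℝ) ^ 2 / 72) * Real.exp (k * v / 12))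
    (fun k _ => by positivity) hk
  refine le_trans ?_ (mul_le_mul_of_nonneg_left h1 (Real.exp_pos _).le)
  rw [← Real.exp_add, ← Real.exp_add]
  apply Real.exp_le_exp.2
  have h2 := Nat.floor_le hv
  have h3 := Nat.lt_floor_add_one v
  set k : ℝ := (⌊v⌋₊ : ℝ)
  have hk0 : 0 ≤ k := Nat.cast_nonneg _
  nlinarith [sq_nonneg (k - 1)]

theorem sum_exp_neg_sq_le (K : ℕ) :
    ∑ k ∈ Finset.range K, Real.exp (-(k : ℝ) ^ 2 / 144) ≤ 145 := by
  have h : ∀ k ∈ Finset.range K, Real.exp (-(k : ℝ) ^ 2 / 144) ≤ (144 / 145 : ℝ) ^ k := by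
    intro k _
    have h1 : Real.exp (-(1 / 144 : ℝ)) ≤ 144 / 145 := by
      rw [Real.exp_neg]
      have := Real.add_one_le_exp (1 / 144 : ℝ)
      rw [inv_le_comm₀ (Real.exp_pos _) (by norm_num)]
      linarith
    calc Real.exp (-(k : ℝ) ^ 2 / 144) ≤ Real.exp (k * (-(1 / 144 : ℝ))) := by
          apply Real.exp_le_exp.2
          rcases Nat.eq_zero_or_pos k with h | h
          · simp [h]
          · have : (1 : ℝ) ≤ k := by exact_mod_cast h
            nlinarith
      _ = Real.exp (-(1 / 144 : ℝ)) ^ k := Real.exp_nat_mul _ _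
      _ ≤ _ := pow_le_pow_left₀ (Real.exp_pos _).le h1 _
  refine (Finset.sum_le_sum h).trans ?_
  rw [geom_sum_eq (by norm_num)]
  have : (0 : ℝ) ≤ (144 / 145 : ℝ) ^ K := by positivity
  norm_num
  linarith

/-- Truncated subgaussian moment of a signed sum of centered Bernoulli variables. -/
theorem rowE_truncated_exp_sq_le (h0 : 0 < p) (h1 : p ≤ 1) (ε : ι → ℝ) (hε : ∀ j, |ε j| = 1)
    (hι : 0 < Fintype.card ι) :
    rowE p (fun r => if |∑ j, (bv (r j) - p) * ε j| ≤ 6 * (p * Fintype.card ι) then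
      Real.exp ((∑ j, (bv (r j) - p) * ε j) ^ 2 / (72 * (p * Fintype.card ι))) else 0) ≤ 600 := by
  set P : ℝ := p * Fintype.card ι
  have hP : 0 < P := mul_pos h0 (by exact_mod_cast hι)
  set σ := Real.sqrt P
  have hσ : 0 < σ := Real.sqrt_pos.2 hP
  have hσ2 : σ ^ 2 = P := Real.sq_sqrt hP.le
  set ξ : (ι → Bool) → ℝ := fun r => ∑ j, (bv (r j) - p) * ε j with hξ
  obtain ⟨K, hK1, hK2⟩ : ∃ K : ℕ, 6 * σ < K ∧ ∀ k ∈ Finset.range K, (k : ℝ) ≤ 6 * σ := by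
    refine ⟨⌊6 * σ⌋₊ + 1, ?_, fun k hk => ?_⟩
    · exact_mod_cast Nat.lt_floor_add_one _
    · rw [Finset.mem_range, Nat.lt_succ_iff] at hk
      exact (Nat.le_floor_iff (by positivity)).1 hk
  have hpt : ∀ r, (if |ξ r| ≤ 6 * P then Real.exp (ξ r ^ 2 / (72 * P)) else 0) ≤
      ∑ k ∈ Finset.range K, Real.exp (1 / 36) * Real.exp (-(k : ℝ) ^ 2 / 72) *
        (Real.exp (k / (12 * σ) * ξ r) + Real.exp (-(k / (12 * σ)) * ξ r)) := by
    intro r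
    split_ifs with h
    · have hv := exp_sq_le_sum_exp (v := |ξ r| / σ) (K := K) (by positivity) (by
        refine lt_of_le_of_lt ?_ hK1
        rw [div_le_iff₀ hσ]; nlinarith)
      have e : (|ξ r| / σ) ^ 2 / 72 = ξ r ^ 2 / (72 * P) := by
        rw [div_pow, sq_abs, hσ2]; field_simp
      rw [e, Finset.mul_sum] at hv
      refine hv.trans (Finset.sum_le_sum fun k _ => ?_)
      rw [mul_assoc]
      gcongr
      have e2 : (k : ℝ) * (|ξ r| / σ) / 12 = k / (12 * σ) * |ξ r| := by field_simp
      rw [e2]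
      rcases abs_cases (ξ r) with ⟨h, _⟩ | ⟨h, _⟩ <;> rw [h]
      · have := Real.exp_pos (-(k / (12 * σ)) * ξ r); linarith
      · have := Real.exp_pos (k / (12 * σ) * ξ r)
        rw [mul_neg, ← neg_mul]; linarith
    · positivity
  refine (rowE_mono h0.le h1 hpt).trans ?_
  rw [rowE_sum]
  -- This is why the moment is truncated: `|ξ| ≤ 6P` needs only `k ≤ 6σ`, so `s = k/(12σ)` stays in
  -- the range where the bound holds. Its cost `e^{k²/144}` uses up half of the weight `e^{-k²/72}`.
  have hmgf : ∀ s : ℝ, |s| ≤ 1 → rowE p (fun r => Real.exp (s * ξ r)) ≤ Real.exp (P * s ^ 2) := by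
    intro s hs
    have := rowE_exp_centered_le h0.le h1 (fun j => s * ε j)
      (fun j => by rw [abs_mul, hε, mul_one]; exact hs)
    have e : p * ∑ j, (s * ε j) ^ 2 = P * s ^ 2 := by
      have : ∀ j, (s * ε j) ^ 2 = s ^ 2 := fun j => by
        rw [mul_pow, ← sq_abs (ε j), hε]; ring
      simp [this, P]; ring
    rw [e] at this
    refine le_trans (le_of_eq ?_) this
    congr 1; funext r; congr 1
    rw [hξ, Finset.mul_sum]; exact Finset.sum_congr rfl fun j _ => by ring
  have hterm : ∀ k ∈ Finset.range K, rowE p (fun r => Real.exp (1 / 36) *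
      Real.exp (-(k : ℝ) ^ 2 / 72) *
        (Real.exp (k / (12 * σ) * ξ r) + Real.exp (-(k / (12 * σ)) * ξ r))) ≤
      (2 * Real.exp (1 / 36)) * Real.exp (-(k : ℝ) ^ 2 / 144) := by
    intro k hk
    have hs : |(k : ℝ) / (12 * σ)| ≤ 1 := by
      rw [abs_of_nonneg (by positivity), div_le_one (by positivity)]
      linarith [hK2 k hk]
    rw [rowE_const_mul, rowE_add]
    have h1 := hmgf _ hs
    have h2 := hmgf (-(k / (12 * σ))) (by rwa [abs_neg])
    have e : P * (k / (12 * σ)) ^ 2 = (k : ℝ) ^ 2 / 144 := by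
      rw [← hσ2]; field_simp; norm_num
    rw [neg_sq] at h2
    rw [e] at h1 h2
    have e3 : Real.exp (-(k : ℝ) ^ 2 / 144) =
        Real.exp (-(k : ℝ) ^ 2 / 72) * Real.exp ((k : ℝ) ^ 2 / 144) := by
      rw [← Real.exp_add]; ring_nf
    calc _ ≤ Real.exp (1 / 36) * Real.exp (-(k : ℝ) ^ 2 / 72) *
          (Real.exp ((k : ℝ) ^ 2 / 144) + Real.exp ((k : ℝ) ^ 2 / 144)) := by gcongr
      _ = _ := by rw [e3]; ring
  refine (Finset.sum_le_sum hterm).trans ?_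
  rw [← Finset.mul_sum]
  have h36 : Real.exp (1 / 36) ≤ 2 := by
    have := exp_le_one_add_add_sq (u := 1 / 36) (by rw [abs_of_pos] <;> norm_num)
    linarith
  have := sum_exp_neg_sq_le K
  have h145 : 0 ≤ ∑ k ∈ Finset.range K, Real.exp (-(k : ℝ) ^ 2 / 144) :=
    Finset.sum_nonneg fun _ _ => (Real.exp_pos _).le
  nlinarith [Real.exp_pos (1 / 36)]

/-! #### Anti-concentration -/

/-- The squared modulus is exactly `1 - 2p(1-p)(1 - cos u)`, and `1 - t ≤ e^{-t}`. -/
theorem norm_charFun_le (u : ℝ) :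
    ‖(p : ℂ) * Complex.exp (u * Complex.I) + (1 - p)‖ ≤
      Real.exp (-(p * (1 - p) * (1 - Real.cos u))) := by
  have h : ‖(p : ℂ) * Complex.exp (u * Complex.I) + (1 - p)‖ ^ 2 =
      1 - 2 * (p * (1 - p) * (1 - Real.cos u)) := by
    rw [← Complex.normSq_eq_norm_sq, Complex.normSq_apply, Complex.exp_mul_I]
    simp [← Complex.ofReal_cos, ← Complex.ofReal_sin]
    linear_combination p ^ 2 * Real.sin_sq_add_cos_sq u
  refine abs_le_of_sq_le_sq' ?_ (Real.exp_pos _).le |>.2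
  rw [h, ← Real.exp_nat_mul]
  have := Real.add_one_le_exp (-(2 * (p * (1 - p) * (1 - Real.cos u))))
  push_cast
  rw [mul_neg]
  linarith

/-- The left side is the real part of the characteristic function, a product over coordinates;
factors outside `J` have modulus at most `1`. -/
theorem rowE_cos_le (h0 : 0 ≤ p) (h1 : p ≤ 1) (x : ι → ℝ) (J : Finset ι) :
    rowE p (fun r => Real.cos (dot r x)) ≤
      Real.exp (-(p * (1 - p) * ∑ j ∈ J, (1 - Real.cos (x j)))) := by
  have hre : rowE p (fun r => Real.cos (dot r x)) =
      (∏ j, ((p : ℂ) * Complex.exp (x j * Complex.I) + (1 - p))).re := by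
    have := sum_prod_bool (R := ℂ)
      (fun (j : ι) b => (bw p b : ℂ) * Complex.exp ((bv b * x j : ℝ) * Complex.I))
    have e : ∀ j, (p : ℂ) * Complex.exp (x j * Complex.I) + (1 - p) =
        (bw p true : ℂ) * Complex.exp ((bv true * x j : ℝ) * Complex.I) +
        (bw p false : ℂ) * Complex.exp ((bv false * x j : ℝ) * Complex.I) := by
      intro j; simp [bw, bv]
    simp only [e]
    rw [← this, Complex.re_sum, rowE]
    refine Finset.sum_congr rfl fun r _ => ?_
    rw [Finset.prod_mul_distrib, ← Complex.exp_sum, ← Finset.sum_mul, ← Complex.ofReal_prod,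
      Complex.re_ofReal_mul, ← Complex.ofReal_sum, Complex.exp_ofReal_mul_I_re]
    rfl
  rw [hre]
  refine (Complex.re_le_norm _).trans ?_
  rw [norm_prod, ← Finset.prod_mul_prod_compl J]
  have hJ : ∏ j ∈ J, ‖(p : ℂ) * Complex.exp (x j * Complex.I) + (1 - p)‖ ≤
      Real.exp (-(p * (1 - p) * ∑ j ∈ J, (1 - Real.cos (x j)))) := by
    rw [Finset.mul_sum, ← Finset.sum_neg_distrib, Real.exp_sum]
    exact Finset.prod_le_prod (fun _ _ => norm_nonneg _) fun j _ => norm_charFun_le _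
  have hJc : ∏ j ∈ Jᶜ, ‖(p : ℂ) * Complex.exp (x j * Complex.I) + (1 - p)‖ ≤ 1 := by
    refine Finset.prod_le_one (fun _ _ => norm_nonneg _) fun j _ => ?_
    refine (norm_charFun_le _).trans (Real.exp_le_one_iff.2 ?_)
    have := Real.cos_le_one (x j)
    have : 0 ≤ p * (1 - p) * (1 - Real.cos (x j)) :=
      mul_nonneg (mul_nonneg h0 (by linarith)) (by linarith)
    linarith
  exact (mul_le_of_le_one_right (Finset.prod_nonneg fun _ _ => norm_nonneg _) hJc).trans hJ

/-- Compare both sides with `1/(1+u²)`: up to `u² = 4` use `cos u ≥ 1 - u²/2`, beyond it `cos u ≥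
-1`. One frequency then replaces a full Fourier inversion. -/
theorem exp_neg_sq_le_cos (u : ℝ) : Real.exp (-u ^ 2) ≤ 3 / 5 + 2 / 5 * Real.cos u := by
  have h1 : Real.exp (-u ^ 2) ≤ 1 / (1 + u ^ 2) := by
    rw [Real.exp_neg, one_div]
    have := Real.add_one_le_exp (u ^ 2)
    exact inv_anti₀ (by positivity) (by linarith)
  refine h1.trans ?_
  rw [div_le_iff₀ (by positivity)]
  have h2 := Real.one_sub_sq_div_two_le_cos (x := u)
  have h3 := Real.neg_one_le_cos u
  rcases le_total (u ^ 2) 4 with h | h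
  · nlinarith [sq_nonneg u]
  · nlinarith [sq_nonneg u]

/-- Anti-concentration of a row on a vector which is spread over the coordinates in `J`. -/
theorem rowE_exp_neg_sq_le_of_flat (h0 : 0 < p) (h1 : p ≤ 1 / 20) (x : ι → ℝ) (J : Finset ι)
    {s : ℝ} (hs : 0 < s) (hx : ∀ j ∈ J, |x j| ≤ Real.sqrt p * s) (hJ : s ^ 2 ≤ ∑ j ∈ J, x j ^ 2) :
    rowE p (fun r => Real.exp (-(9 / (p * s ^ 2) * dot r x ^ 2))) ≤ 7 / 10 := by
  -- This frequency keeps `|θ x_j| ≤ 3 < π` on `J`, where `1 - cos` is quadratically large, while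
  -- `θ² s² = 9/p` cancels the sparsity `p`.
  set θ : ℝ := 3 / (Real.sqrt p * s)
  have hp := Real.sqrt_pos.2 h0
  have hθ : θ ^ 2 = 9 / (p * s ^ 2) := by
    simp only [θ, div_pow, mul_pow, Real.sq_sqrt h0.le]; norm_num
  have hdot : ∀ r, dot r (fun j => θ * x j) = θ * dot r x := fun r => by
    simp only [dot, Finset.mul_sum]; exact Finset.sum_congr rfl fun j _ => by ring
  have hpt : ∀ r, Real.exp (-(9 / (p * s ^ 2) * dot r x ^ 2)) ≤
      3 / 5 + 2 / 5 * Real.cos (dot r (fun j => θ * x j)) := fun r => by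
    rw [hdot, ← hθ, ← mul_pow]; exact exp_neg_sq_le_cos _
  refine (rowE_mono h0.le (by linarith) hpt).trans ?_
  rw [rowE_add, rowE_const, rowE_const_mul]
  have hc := rowE_cos_le h0.le (by linarith) (fun j => θ * x j) J
  have hsum : 9 / (5 * p) ≤ ∑ j ∈ J, (1 - Real.cos (θ * x j)) := by
    calc 9 / (5 * p) = 1 / 5 * (θ ^ 2 * s ^ 2) := by rw [hθ]; field_simp
      _ ≤ 1 / 5 * (θ ^ 2 * ∑ j ∈ J, x j ^ 2) := by gcongr
      _ = ∑ j ∈ J, 1 / 5 * (θ * x j) ^ 2 := by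
        simp only [Finset.mul_sum]; exact Finset.sum_congr rfl fun j _ => by ring
      _ ≤ _ := by
        refine Finset.sum_le_sum fun j hj => ?_
        have hb : |θ * x j| ≤ 3 := by
          rw [abs_mul, abs_of_pos (by positivity)]
          calc θ * |x j| ≤ θ * (Real.sqrt p * s) := by gcongr; exact hx j hj
            _ = 3 := by simp only [θ]; field_simp
        have := Real.cos_le_one_sub_mul_cos_sq (hb.trans Real.pi_gt_three.le)
        have hpi : (1 : ℝ) / 5 ≤ 2 / Real.pi ^ 2 := by
          rw [div_le_div_iff₀ (by norm_num) (by positivity)]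
          nlinarith [Real.pi_lt_d2, Real.pi_pos]
        nlinarith [sq_nonneg (θ * x j)]
  have he : Real.exp (-(p * (1 - p) * ∑ j ∈ J, (1 - Real.cos (θ * x j)))) ≤ 1 / 4 := by
    have h2 : (171 / 100 : ℝ) ≤ p * (1 - p) * ∑ j ∈ J, (1 - Real.cos (θ * x j)) := by
      calc (171 / 100 : ℝ) ≤ (1 - p) * (9 / 5) := by linarith
        _ = p * (1 - p) * (9 / (5 * p)) := by field_simp
        _ ≤ _ := by
          have : 0 ≤ 1 - p := by linarith
          gcongr
    rw [Real.exp_neg, one_div]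
    refine inv_anti₀ (by norm_num) ?_
    have h3 : (4 : ℝ) ≤ Real.exp (171 / 100) := by
      have h4 := Real.add_one_le_exp (171 / 400 : ℝ)
      calc (4 : ℝ) ≤ (171 / 400 + 1) ^ 4 := by norm_num
        _ ≤ Real.exp (171 / 400) ^ 4 := by gcongr
        _ = Real.exp (171 / 100) := by rw [← Real.exp_nat_mul]; norm_num
    exact h3.trans (Real.exp_le_exp.2 h2)
  linarith

theorem dot_update_true (r : ι → Bool) (x : ι → ℝ) (j : ι) :
    dot (Function.update r j true) x = dot (Function.update r j false) x + x j := by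
  have h : ∀ b, dot (Function.update r j b) x =
      bv b * x j + ∑ i ∈ Finset.univ.erase j, bv (r i) * x i := by
    intro b
    rw [dot, ← Finset.add_sum_erase _ _ (Finset.mem_univ j)]
    congr 1
    · simp
    · exact Finset.sum_congr rfl fun i hi => by
        rw [Function.update_of_ne (Finset.ne_of_mem_erase hi)]
  rw [h, h]; simp [bv]; ring

/-- Anti-concentration of a row on a vector with two large coordinates. -/
theorem rowE_exp_neg_sq_le_of_two_large (h0 : 0 < p) (h1 : p ≤ 1 / 20) (x : ι → ℝ) {j k : ι}
    (hjk : j ≠ k) {s : ℝ} (hs : 0 < s) (hj : s ≤ |x j|) (hk : s ≤ |x k|) :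
    rowE p (fun r => Real.exp (-(20 / s ^ 2 * dot r x ^ 2))) ≤ Real.exp (-(1.88 * p)) := by
  set h : ℝ → ℝ := fun y => Real.exp (-(20 / s ^ 2 * y ^ 2))
  have hle : ∀ y, h y ≤ 1 := fun y => Real.exp_le_one_iff.2 (by
    have : 0 ≤ 20 / s ^ 2 * y ^ 2 := by positivity
    linarith)
  have hsmall : ∀ y, s / 2 ≤ |y| → h y ≤ 1 / 100 := by
    intro y hy
    have h2 : (5 : ℝ) ≤ 20 / s ^ 2 * y ^ 2 := by
      rw [← sq_abs y, div_mul_eq_mul_div, le_div_iff₀ (by positivity)]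
      nlinarith
    simp only [h]
    rw [Real.exp_neg, one_div]
    refine inv_anti₀ (by norm_num) ?_
    have h4 := Real.exp_one_gt_d9
    calc (100 : ℝ) ≤ 2.7 ^ 5 := by norm_num
      _ ≤ Real.exp 1 ^ 5 := by gcongr; linarith
      _ = Real.exp 5 := by rw [← Real.exp_nat_mul]; norm_num
      _ ≤ _ := Real.exp_le_exp.2 h2
  rw [rowE_resample j]
  rw [rowE_resample k]
  have hpt : ∀ r : ι → Bool,
      (p * (p * h (dot (Function.update (Function.update r k true) j true) x) +
        (1 - p) * h (dot (Function.update (Function.update r k true) j false) x)) +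
      (1 - p) * (p * h (dot (Function.update (Function.update r k false) j true) x) +
        (1 - p) * h (dot (Function.update (Function.update r k false) j false) x))) ≤
      Real.exp (-(1.88 * p)) := by
    intro r
    have c : ∀ b b' : Bool, Function.update (Function.update r k b) j b' =
        Function.update (Function.update r j b') k b := fun b b' =>
      Function.update_comm hjk.symm _ _ _
    have e3 : dot (Function.update (Function.update r k true) j false) x =
        dot (Function.update (Function.update r k false) j false) x + x k := by
      rw [c, dot_update_true, c]
    have e4 : dot (Function.update (Function.update r k false) j true) x =
        dot (Function.update (Function.update r k false) j false) x + x j := dot_update_true _ _ _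
    set d := dot (Function.update (Function.update r k false) j false) x
    rw [e3, e4]
    set d' := dot (Function.update (Function.update r k true) j true) x
    have hexp := Real.add_one_le_exp (-(1.88 * p))
    have hpos : ∀ y, 0 < h y := fun y => Real.exp_pos _
    -- `d` is the value with both entries off. If it is small, switching on exactly one entry makes
    -- the value large, and the average is at most `1 - 2p(1-p)(0.99) ≤ 1 - 1.88p`. If it is large,
    -- the likely outcome with both entries off already gives a gain.
    rcases lt_or_ge |d| (s / 2) with hd | hd
    · have hk' : h (d + x k) ≤ 1 / 100 := hsmall _ (by
        have := abs_sub_abs_le_abs_sub (x k) (-d)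
        rw [abs_neg, sub_neg_eq_add, add_comm (x k)] at this
        linarith)
      have hj' : h (d + x j) ≤ 1 / 100 := hsmall _ (by
        have := abs_sub_abs_le_abs_sub (x j) (-d)
        rw [abs_neg, sub_neg_eq_add, add_comm (x j)] at this
        linarith)
      have a1 : p * h d' ≤ p * 1 := by gcongr; exact hle _
      have a2 : (1 - p) * h (d + x k) ≤ (1 - p) * (1 / 100) :=
        mul_le_mul_of_nonneg_left hk' (by linarith)
      have a3 : p * h (d + x j) ≤ p * (1 / 100) := by gcongr
      have a4 : (1 - p) * h d ≤ (1 - p) * 1 := mul_le_mul_of_nonneg_left (hle _) (by linarith)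
      have b1 := mul_le_mul_of_nonneg_left (add_le_add a1 a2) h0.le
      have b2 := mul_le_mul_of_nonneg_left (add_le_add a3 a4) (show 0 ≤ 1 - p by linarith)
      nlinarith
    · have hd' := hsmall _ hd
      have a1 : p * h d' ≤ p * 1 := by gcongr; exact hle _
      have a2 : (1 - p) * h (d + x k) ≤ (1 - p) * 1 :=
        mul_le_mul_of_nonneg_left (hle _) (by linarith)
      have a3 : p * h (d + x j) ≤ p * 1 := by gcongr; exact hle _
      have a4 : (1 - p) * h d ≤ (1 - p) * (1 / 100) :=
        mul_le_mul_of_nonneg_left hd' (by linarith)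
      have b1 := mul_le_mul_of_nonneg_left (add_le_add a1 a2) h0.le
      have b2 := mul_le_mul_of_nonneg_left (add_le_add a3 a4) (show 0 ≤ 1 - p by linarith)
      nlinarith
  refine (rowE_mono h0.le (by linarith) hpt).trans ?_
  rw [rowE_const]

end Row

/-! ### Events for the whole matrix -/

section Mat

variable {n : ℕ} {p : ℝ}

theorem matP_zero_column_le (h0 : 0 ≤ p) (h1 : p ≤ 1) :
    matP p {b : Fin n → Fin n → Bool | ∃ j, ∀ i, b i j = false} ≤ n * (1 - p) ^ n := by
  have e : {b : Fin n → Fin n → Bool | ∃ j, ∀ i, b i j = false} =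
      ⋃ j ∈ (Finset.univ : Finset (Fin n)), {b | ∀ i, b i j = false} := by
    ext b; simp
  rw [e]
  refine (matP_biUnion_le h0 h1 Finset.univ _ (a := (1 - p) ^ n) fun j _ => ?_).trans_eq (by simp)
  have h := mul_matP_le h0 h1 (S := {b : Fin n → Fin n → Bool | ∀ i, b i j = false})
    (fun _ r => ∏ k, if k = j then (if r k then 0 else 1) else 1)
    (fun _ r => Finset.prod_nonneg fun k _ => by split_ifs <;> norm_num) 1 (fun b hb => by
      have hb : ∀ i, b i j = false := hb
      rw [Finset.prod_eq_one]
      intro i _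
      refine Finset.prod_eq_one fun k _ => ?_
      by_cases hk : k = j <;> simp [hk, hb])
  rw [one_mul] at h
  refine h.trans_eq ?_
  rw [Finset.prod_const, Finset.card_univ, Fintype.card_fin]
  congr 1
  rw [rowE_prod (fun k b => if k = j then (if b then 0 else 1) else 1)]
  rw [Finset.prod_eq_single j (fun k _ hk => by simp [hk]) (by simp)]
  simp

/-- Chernoff with exponent `1` gives `e^{2pn - 5pn}` for one row, and `n ≤ e^{pn}` pays for the
union over rows. -/
theorem matP_large_row_le (h0 : 0 ≤ p) (h1 : p ≤ 1) (hn : (n : ℝ) ≤ Real.exp (p * n)) :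
    matP p {b : Fin n → Fin n → Bool | ∃ i, 5 * (p * n) < ∑ j, bv (b i j)} ≤
      Real.exp (-(1.5 * n * p)) := by
  have e : {b : Fin n → Fin n → Bool | ∃ i, 5 * (p * n) < ∑ j, bv (b i j)} =
      ⋃ i ∈ (Finset.univ : Finset (Fin n)), {b | 5 * (p * n) < ∑ j, bv (b i j)} := by
    ext b; simp
  rw [e]
  have key : ∀ i : Fin n, matP p {b : Fin n → Fin n → Bool | 5 * (p * n) < ∑ j, bv (b i j)} ≤
      Real.exp (-(3 * (p * n))) := by
    intro i
    have h := mul_matP_le h0 h1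
      (S := {b : Fin n → Fin n → Bool | 5 * (p * n) < ∑ j, bv (b i j)})
      (fun k r => if k = i then Real.exp (∑ j, bv (r j)) else 1)
      (fun _ r => by split_ifs <;> positivity) (Real.exp (5 * (p * n))) (fun b hb => by
        have hb : 5 * (p * n) < ∑ j, bv (b i j) := hb
        rw [Finset.prod_eq_single i (fun k _ hk => by simp [hk]) (by simp)]
        simpa using hb.le)
    rw [Finset.prod_eq_single i (fun k _ hk => by simp [hk, rowE_const]) (by simp)] at h
    simp only [if_true] at h
    have h2 := h.trans (rowE_exp_rowSum_le h0 h1)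
    rw [Fintype.card_fin, mul_comm, ← le_div_iff₀ (Real.exp_pos _), ← Real.exp_sub] at h2
    exact h2.trans_eq (by ring_nf)
  refine (matP_biUnion_le h0 h1 Finset.univ _ fun i _ => key i).trans ?_
  rw [Finset.card_univ, Fintype.card_fin]
  calc (n : ℝ) * Real.exp (-(3 * (p * n))) ≤ Real.exp (p * n) * Real.exp (-(3 * (p * n))) := by
        gcongr
    _ = Real.exp (-(2 * (p * n))) := by rw [← Real.exp_add]; ring_nf
    _ ≤ _ := Real.exp_le_exp.2 (by
        have : 0 ≤ p * n := by positivity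
        linarith)

/-- Real sign attached to a Boolean. -/
def sg (b : Bool) : ℝ := if b then 1 else -1

theorem abs_sg (b : Bool) : |sg b| = 1 := by cases b <;> simp [sg]

theorem matP_signs_le (h0 : 0 < p) (h1 : p ≤ 1) :
    matP p {b : Fin n → Fin n → Bool | (∀ i, ∑ j, bv (b i j) ≤ 5 * (p * n)) ∧
      ∃ ε : Fin n → Bool, 648 * p * n ^ 2 < ∑ i, (∑ j, (bv (b i j) - p) * sg (ε j)) ^ 2} ≤
      Real.exp (-n) := by
  rcases Nat.eq_zero_or_pos n with hn | hn
  · subst hn; simp [matP]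
  have hn' : (0 : ℝ) < n := by exact_mod_cast hn
  -- Since `648 = 9·72`, Markov's inequality gains `e^{-9n}`, against `600^n` from the row moments
  -- and `2^n` from the later union over signs. The bound on row sums puts every row inside the
  -- truncation.
  have key : ∀ ε : Fin n → Bool, matP p {b : Fin n → Fin n → Bool |
      (∀ i, ∑ j, bv (b i j) ≤ 5 * (p * n)) ∧
      648 * p * n ^ 2 < ∑ i, (∑ j, (bv (b i j) - p) * sg (ε j)) ^ 2} ≤
      600 ^ n * Real.exp (-(9 * n)) := by
    intro ε
    have h := mul_matP_le h0.le h1 (S := {b : Fin n → Fin n → Bool |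
      (∀ i, ∑ j, bv (b i j) ≤ 5 * (p * n)) ∧
      648 * p * n ^ 2 < ∑ i, (∑ j, (bv (b i j) - p) * sg (ε j)) ^ 2})
      (fun _ r => if |∑ j, (bv (r j) - p) * sg (ε j)| ≤ 6 * (p * n) then
        Real.exp ((∑ j, (bv (r j) - p) * sg (ε j)) ^ 2 / (72 * (p * n))) else 0)
      (fun _ r => by split_ifs <;> positivity) (Real.exp (9 * n)) (by
        rintro b ⟨hb1, hb2⟩
        have hb : ∀ i, |∑ j, (bv (b i j) - p) * sg (ε j)| ≤ 6 * (p * n) := by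
          intro i
          calc |∑ j, (bv (b i j) - p) * sg (ε j)| ≤ ∑ j, |(bv (b i j) - p) * sg (ε j)| :=
                Finset.abs_sum_le_sum_abs _ _
            _ ≤ ∑ j, (bv (b i j) + p) := by
                refine Finset.sum_le_sum fun j _ => ?_
                rw [abs_mul, abs_sg, mul_one]
                have : 0 ≤ bv (b i j) := by unfold bv; split_ifs <;> norm_num
                exact abs_le.2 ⟨by linarith, by linarith⟩
            _ ≤ 6 * (p * n) := by
                rw [Finset.sum_add_distrib]
                have := hb1 i
                simp only [Finset.sum_const, Finset.card_univ, Fintype.card_fin, nsmul_eq_mul]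
                linarith
        simp only [hb, if_true]
        rw [← Real.exp_sum, ← Finset.sum_div]
        apply Real.exp_le_exp.2
        rw [le_div_iff₀ (by positivity)]
        nlinarith)
    have hr := rowE_truncated_exp_sq_le (ι := Fin n) h0 h1 (fun j => sg (ε j))
      (fun j => abs_sg _) (by simpa using hn)
    rw [Fintype.card_fin] at hr
    rw [Finset.prod_const, Finset.card_univ, Fintype.card_fin] at h
    have h2 := h.trans (pow_le_pow_left₀ (rowE_nonneg h0.le h1 fun r => by
      split_ifs <;> positivity) hr n)
    rw [mul_comm, ← le_div_iff₀ (Real.exp_pos _)] at h2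
    rw [Real.exp_neg]; exact h2
  have e : {b : Fin n → Fin n → Bool | (∀ i, ∑ j, bv (b i j) ≤ 5 * (p * n)) ∧
      ∃ ε : Fin n → Bool, 648 * p * n ^ 2 < ∑ i, (∑ j, (bv (b i j) - p) * sg (ε j)) ^ 2} =
      ⋃ ε ∈ (Finset.univ : Finset (Fin n → Bool)), {b : Fin n → Fin n → Bool |
      (∀ i, ∑ j, bv (b i j) ≤ 5 * (p * n)) ∧
      648 * p * n ^ 2 < ∑ i, (∑ j, (bv (b i j) - p) * sg (ε j)) ^ 2} := by
    ext b; simp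
  rw [e]
  refine (matP_biUnion_le h0.le h1 Finset.univ _ fun ε _ => key ε).trans ?_
  rw [Finset.card_univ, Fintype.card_fun, Fintype.card_bool, Fintype.card_fin]
  have h1200 : (1200 : ℝ) ≤ Real.exp 8 := by
    have h4 := Real.exp_one_gt_d9
    calc (1200 : ℝ) ≤ 2.7 ^ 8 := by norm_num
      _ ≤ Real.exp 1 ^ 8 := by gcongr; linarith
      _ = Real.exp 8 := by rw [← Real.exp_nat_mul]; norm_num
  calc ((2 ^ n : ℕ) : ℝ) * (600 ^ n * Real.exp (-(9 * n))) = 1200 ^ n * Real.exp (-(9 * n)) := by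
        push_cast; rw [← mul_assoc, ← mul_pow]; norm_num
    _ ≤ Real.exp 8 ^ n * Real.exp (-(9 * n)) := by gcongr
    _ = Real.exp (-n) := by rw [← Real.exp_nat_mul, ← Real.exp_add]; ring_nf

/-- The image of a vector under a `0/1` matrix. -/
noncomputable def mv (b : Fin n → Fin n → Bool) (x : EuclideanSpace ℝ (Fin n)) :
    EuclideanSpace ℝ (Fin n) := WithLp.toLp 2 fun i => dot (b i) x

theorem mv_eq_mulVec (b : Fin n → Fin n → Bool) (x : EuclideanSpace ℝ (Fin n)) :
    (WithLp.toLp 2 (Matrix.mulVec (Matrix.of fun i j => bv (b i j)) x) :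
      EuclideanSpace ℝ (Fin n)) = mv b x := rfl

theorem norm_mv_sq (b : Fin n → Fin n → Bool) (x : EuclideanSpace ℝ (Fin n)) :
    ‖mv b x‖ ^ 2 = ∑ i, dot (b i) x ^ 2 := by
  rw [EuclideanSpace.norm_sq_eq]; simp [mv]

theorem mv_sub (b : Fin n → Fin n → Bool) (x y : EuclideanSpace ℝ (Fin n)) :
    mv b (x - y) = mv b x - mv b y := by
  ext i; simp [mv, dot, mul_sub, Finset.sum_sub_distrib]

/-- A bound for all sign vectors extends to all vectors in the cube. -/
theorem norm_centered_le {b : Fin n → Fin n → Bool} {R : ℝ} (hR : 0 ≤ R)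
    (hb : ∀ ε : Fin n → Bool, ∑ i, (∑ j, (bv (b i j) - p) * sg (ε j)) ^ 2 ≤ R ^ 2)
    {z : Fin n → ℝ} {ρ : ℝ} (hρ : 0 < ρ) (hz : ∀ j, |z j| ≤ ρ) :
    ‖(WithLp.toLp 2 fun i => ∑ j, (bv (b i j) - p) * z j : EuclideanSpace ℝ (Fin n))‖ ≤
      R * ρ := by
  set T : (Fin n → ℝ) →ₗ[ℝ] EuclideanSpace ℝ (Fin n) :=
    (WithLp.linearEquiv 2 ℝ (Fin n → ℝ)).symm.toLinearMap ∘ₗ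
      Matrix.mulVecLin (Matrix.of fun i j => bv (b i j) - p) with hT
  have hTz : ∀ y : Fin n → ℝ, T y = WithLp.toLp 2 fun i => ∑ j, (bv (b i j) - p) * y j :=
    fun y => rfl
  -- A convex function at a point of the cube is at most its value at some vertex.
  have hconv : ConvexOn ℝ Set.univ (fun y => ‖T y‖) := convexOn_univ_norm.comp_linearMap T
  have hmem : (ρ⁻¹ • z) ∈ convexHull ℝ (Set.univ.pi fun _ : Fin n => ({-1, 1} : Set ℝ)) := by
    rw [convexHull_pi]
    intro j _
    rw [convexHull_pair, segment_eq_Icc (by norm_num)]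
    have : |(ρ⁻¹ • z) j| ≤ 1 := by
      rw [Pi.smul_apply, smul_eq_mul, abs_mul, abs_of_pos (inv_pos.2 hρ), inv_mul_le_iff₀ hρ,
        mul_one]
      exact hz j
    exact abs_le.1 this
  obtain ⟨y, hy, hle⟩ := hconv.exists_ge_of_mem_convexHull (Set.subset_univ _) hmem
  have hy' : y = fun j => sg (decide (y j = 1)) := by
    funext j
    rcases hy j trivial with h | h
    · rw [h]; norm_num [sg]
    · rw [h]; simp [sg]
  have hyR : ‖T y‖ ≤ R := by
    refine abs_le_of_sq_le_sq' ?_ hR |>.2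
    rw [hTz, EuclideanSpace.norm_sq_eq, hy']
    simpa using hb _
  have : T z = ρ • T (ρ⁻¹ • z) := by rw [map_smul, smul_smul, mul_inv_cancel₀ hρ.ne', one_smul]
  rw [← hTz, this, norm_smul, Real.norm_of_nonneg hρ.le, mul_comm]
  exact mul_le_mul_of_nonneg_right (hle.trans hyR) hρ.le

/-- The rank-one mean `p·11ᵀ` is too large to be controlled by sup norm alone, so it is split off
and charged to the coordinate sum. -/
theorem norm_mv_le (h0 : 0 ≤ p) {b : Fin n → Fin n → Bool}
    (hb : ∀ ε : Fin n → Bool,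
      ∑ i, (∑ j, (bv (b i j) - p) * sg (ε j)) ^ 2 ≤ 648 * p * n ^ 2)
    {z : EuclideanSpace ℝ (Fin n)} {ρ : ℝ} (hρ : 0 < ρ) (hz : ∀ j, |z j| ≤ ρ) :
    ‖mv b z‖ ≤ 26 * Real.sqrt p * n * ρ + p * Real.sqrt n * |∑ j, z j| := by
  have e : mv b z = (WithLp.toLp 2 fun i => ∑ j, (bv (b i j) - p) * z j) +
      (p * ∑ j, z j) • (WithLp.toLp 2 fun _ => 1) := by
    ext i
    simp [mv, dot, sub_mul, Finset.sum_sub_distrib, Finset.mul_sum]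
  have h1 : ‖(WithLp.toLp 2 fun _ => 1 : EuclideanSpace ℝ (Fin n))‖ = Real.sqrt n := by
    rw [EuclideanSpace.norm_eq]; simp
  rw [e]
  refine (norm_add_le _ _).trans (add_le_add ?_ ?_)
  · refine norm_centered_le (by positivity) (fun ε => (hb ε).trans ?_) hρ hz
    rw [mul_pow, mul_pow, Real.sq_sqrt h0]
    have : 0 ≤ p * (n : ℝ) ^ 2 := by positivity
    nlinarith
  · rw [norm_smul, h1, Real.norm_eq_abs, abs_mul, abs_of_nonneg h0]
    exact le_of_eq (by ring)

/-- Tensorization: Markov applied to `e^{-t‖Mx‖²}`, which is a product over independent rows. -/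
theorem matP_sum_sq_le (h0 : 0 ≤ p) (h1 : p ≤ 1) (x : EuclideanSpace ℝ (Fin n)) {t q a : ℝ}
    (ht : 0 ≤ t) (hq : rowE p (fun r : Fin n → Bool => Real.exp (-(t * dot r x ^ 2))) ≤ q) :
    matP p {b : Fin n → Fin n → Bool | ‖mv b x‖ ^ 2 ≤ a} ≤ Real.exp (t * a) * q ^ n := by
  have h := mul_matP_le h0 h1 (S := {b : Fin n → Fin n → Bool | ‖mv b x‖ ^ 2 ≤ a})
    (fun _ r => Real.exp (-(t * dot r x ^ 2))) (fun _ _ => (Real.exp_pos _).le)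
    (Real.exp (-(t * a))) (fun b hb => by
      have hb : ‖mv b x‖ ^ 2 ≤ a := hb
      rw [← Real.exp_sum, Finset.sum_neg_distrib, ← Finset.mul_sum, ← norm_mv_sq]
      exact Real.exp_le_exp.2 (neg_le_neg (mul_le_mul_of_nonneg_left hb ht)))
  rw [Finset.prod_const, Finset.card_univ, Fintype.card_fin] at h
  have h2 := h.trans (pow_le_pow_left₀ (rowE_nonneg h0 h1 fun _ => (Real.exp_pos _).le) hq n)
  rw [Real.exp_neg, inv_mul_le_iff₀ (Real.exp_pos _)] at h2
  exact h2

/-- Small ball probability for a vector which is spread over the coordinates in `J`. -/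
theorem matP_small_le_of_flat (h0 : 0 < p) (h1 : p ≤ 1 / 20) (x : EuclideanSpace ℝ (Fin n))
    (J : Finset (Fin n)) {s : ℝ} (hs : 0 < s) (hx : ∀ j ∈ J, |x j| ≤ Real.sqrt p * s)
    (hJ : s ^ 2 ≤ ∑ j ∈ J, x j ^ 2) :
    matP p {b : Fin n → Fin n → Bool | ‖mv b x‖ ≤ 1 / 40 * s * Real.sqrt (p * n)} ≤
      Real.exp (-(1.85 * (p * n))) := by
  have hr := rowE_exp_neg_sq_le_of_flat h0 h1 x J hs hx hJ
  have h := matP_sum_sq_le (a := (1 / 40 * s * Real.sqrt (p * n)) ^ 2) h0.le (by linarith) x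
    (by positivity) hr
  refine (matP_mono h0.le (by linarith) fun b hb => ?_).trans (h.trans ?_)
  · exact pow_le_pow_left₀ (norm_nonneg _) hb 2
  · have e : 9 / (p * s ^ 2) * (1 / 40 * s * Real.sqrt (p * n)) ^ 2 = 9 / 1600 * n := by
      rw [mul_pow, Real.sq_sqrt (by positivity)]; field_simp; norm_num; ring
    have h7 : (7 / 10 : ℝ) ≤ Real.exp (-(3 / 10)) := by
      have := Real.add_one_le_exp (-(3 / 10) : ℝ); linarith
    rw [e]
    calc Real.exp (9 / 1600 * n) * (7 / 10) ^ n ≤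
          Real.exp (9 / 1600 * n) * Real.exp (-(3 / 10)) ^ n := by gcongr
      _ = Real.exp ((9 / 1600 - 3 / 10) * n) := by
          rw [← Real.exp_nat_mul, ← Real.exp_add]; ring_nf
      _ ≤ _ := Real.exp_le_exp.2 (by
          have hn : (0 : ℝ) ≤ n := Nat.cast_nonneg n
          nlinarith)

/-- Small ball probability for a vector with two large coordinates. -/
theorem matP_small_le_of_two_large (h0 : 0 < p) (h1 : p ≤ 1 / 20)
    (x : EuclideanSpace ℝ (Fin n)) {j k : Fin n} (hjk : j ≠ k) {s : ℝ} (hs : 0 < s)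
    (hj : s ≤ |x j|) (hk : s ≤ |x k|) :
    matP p {b : Fin n → Fin n → Bool | ‖mv b x‖ ≤ 1 / 40 * s * Real.sqrt (p * n)} ≤
      Real.exp (-(1.85 * (p * n))) := by
  have hr := rowE_exp_neg_sq_le_of_two_large h0 h1 x hjk hs hj hk
  have h := matP_sum_sq_le (a := (1 / 40 * s * Real.sqrt (p * n)) ^ 2) h0.le (by linarith) x
    (by positivity) hr
  refine (matP_mono h0.le (by linarith) fun b hb => ?_).trans (h.trans ?_)
  · exact pow_le_pow_left₀ (norm_nonneg _) hb 2
  · have e : 20 / s ^ 2 * (1 / 40 * s * Real.sqrt (p * n)) ^ 2 = 1 / 80 * (p * n) := by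
      rw [mul_pow, Real.sq_sqrt (by positivity)]; field_simp; norm_num; ring
    rw [e, ← Real.exp_nat_mul, ← Real.exp_add]
    refine Real.exp_le_exp.2 ?_
    have : 0 ≤ p * n := by positivity
    nlinarith

end Mat

/-! ### Counting lattice points -/

theorem sum_Icc_exp_neg_abs_le (L : ℕ) {ρ : ℝ} (hρ : 1 ≤ ρ) :
    ∑ k ∈ Finset.Icc (-(L : ℤ)) L, Real.exp (-(|(k : ℝ)| / ρ)) ≤ 4 * ρ := by
  classical
  set f : ℤ → ℝ := fun k => Real.exp (-(|(k : ℝ)| / ρ))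
  have hf : ∀ k, 0 ≤ f k := fun k => (Real.exp_pos _).le
  set P := (Finset.range (L + 1)).image (fun k : ℕ => (k : ℤ))
  set N := (Finset.range (L + 1)).image (fun k : ℕ => -(k : ℤ))
  have hsub : Finset.Icc (-(L : ℤ)) L ⊆ P ∪ N := by
    intro k hk
    rw [Finset.mem_Icc] at hk
    simp only [P, N, Finset.mem_union, Finset.mem_image, Finset.mem_range]
    rcases le_total 0 k with h | h
    · exact Or.inl ⟨k.toNat, by omega, by omega⟩
    · exact Or.inr ⟨(-k).toNat, by omega, by omega⟩
  have hgeo : ∑ k ∈ Finset.range (L + 1), Real.exp (-((k : ℝ) / ρ)) ≤ 2 * ρ := by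
    have hr : Real.exp (-(1 / ρ)) ≤ ρ / (ρ + 1) := by
      have := Real.add_one_le_exp (1 / ρ)
      rw [Real.exp_neg, inv_le_comm₀ (Real.exp_pos _) (by positivity)]
      refine le_trans (le_of_eq ?_) this
      field_simp
      ring
    have hr1 : ρ / (ρ + 1) < 1 := by rw [div_lt_one (by linarith)]; linarith
    calc ∑ k ∈ Finset.range (L + 1), Real.exp (-((k : ℝ) / ρ))
        ≤ ∑ k ∈ Finset.range (L + 1), (ρ / (ρ + 1)) ^ k := by
          refine Finset.sum_le_sum fun k _ => ?_
          calc Real.exp (-((k : ℝ) / ρ)) = Real.exp (-(1 / ρ)) ^ k := by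
                rw [← Real.exp_nat_mul]; ring_nf
            _ ≤ _ := pow_le_pow_left₀ (Real.exp_pos _).le hr k
      _ ≤ (1 - ρ / (ρ + 1))⁻¹ := by
          rw [Finset.range_eq_Ico]
          refine (geom_sum_Ico_le_of_lt_one (by positivity) hr1).trans_eq ?_
          rw [pow_zero, one_div]
      _ = ρ + 1 := by field_simp; ring
      _ ≤ 2 * ρ := by linarith
  have hP : ∑ k ∈ P, f k ≤ 2 * ρ := by
    rw [Finset.sum_image (fun a _ b _ h => by simpa using h)]
    refine le_trans (le_of_eq (Finset.sum_congr rfl fun k _ => ?_)) hgeo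
    simp [f]
  have hN : ∑ k ∈ N, f k ≤ 2 * ρ := by
    rw [Finset.sum_image (fun a _ b _ h => by simpa using h)]
    refine le_trans (le_of_eq (Finset.sum_congr rfl fun k _ => ?_)) hgeo
    simp [f]
  calc ∑ k ∈ Finset.Icc (-(L : ℤ)) L, f k ≤ ∑ k ∈ P ∪ N, f k :=
        Finset.sum_le_sum_of_subset_of_nonneg hsub fun k _ _ => hf k
    _ ≤ ∑ k ∈ P, f k + ∑ k ∈ N, f k := by
        rw [← Finset.sum_union_inter]
        exact le_add_of_nonneg_right (Finset.sum_nonneg fun k _ => hf k)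
    _ ≤ 4 * ρ := by linarith

/-- Integer vectors which vanish on `A` and have `ℓ₁`-norm at most `r`. -/
noncomputable def latticeBall {n : ℕ} (A : Finset (Fin n)) (r : ℝ) : Finset (Fin n → ℤ) :=
  (Fintype.piFinset fun i => if i ∈ A then {0} else Finset.Icc (-(⌊r⌋₊ : ℤ)) ⌊r⌋₊).filter
    fun g => ∑ i, |(g i : ℝ)| ≤ r

theorem mem_latticeBall {n : ℕ} {A : Finset (Fin n)} {r : ℝ} {g : Fin n → ℤ}
    (h0 : ∀ i ∈ A, g i = 0) (hr : ∑ i, |(g i : ℝ)| ≤ r) : g ∈ latticeBall A r := by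
  rw [latticeBall, Finset.mem_filter, Fintype.mem_piFinset]
  refine ⟨fun i => ?_, hr⟩
  split_ifs with h
  · simp [h0 i h]
  · have h1 : |(g i : ℝ)| ≤ r :=
      (Finset.single_le_sum (f := fun i => |(g i : ℝ)|) (fun _ _ => abs_nonneg _)
        (Finset.mem_univ i)).trans hr
    have h2 : (g i).natAbs ≤ ⌊r⌋₊ := Nat.le_floor (by rw [Nat.cast_natAbs, Int.cast_abs]; exact h1)
    rw [Finset.mem_Icc]; omega

theorem card_latticeBall_le {n m : ℕ} (A : Finset (Fin n)) (hA : Aᶜ.card = m) {ρ : ℝ}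
    (hρ : 1 ≤ ρ) : ((latticeBall A (m * ρ)).card : ℝ) ≤ (Real.exp 1 * (4 * ρ)) ^ m := by
  have hρ0 : 0 < ρ := by linarith
  set T := fun i : Fin n => if i ∈ A then ({0} : Finset ℤ)
    else Finset.Icc (-(⌊m * ρ⌋₊ : ℤ)) ⌊m * ρ⌋₊
  calc ((latticeBall A (m * ρ)).card : ℝ) = ∑ g ∈ latticeBall A (m * ρ), (1 : ℝ) := by simp
    -- The constraint `‖g‖₁ ≤ mρ` becomes a weight at least `1`; the sum then factors into geometric
    -- series over the `m` free coordinates.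
    _ ≤ ∑ g ∈ latticeBall A (m * ρ), Real.exp (m - (∑ i, |(g i : ℝ)|) / ρ) := by
        refine Finset.sum_le_sum fun g hg => Real.one_le_exp ?_
        have : (∑ i, |(g i : ℝ)|) / ρ ≤ m := by
          rw [div_le_iff₀ hρ0]; exact (Finset.mem_filter.1 hg).2
        linarith
    _ ≤ ∑ g ∈ Fintype.piFinset T, Real.exp (m - (∑ i, |(g i : ℝ)|) / ρ) :=
        Finset.sum_le_sum_of_subset_of_nonneg (Finset.filter_subset _ _)
          fun _ _ _ => (Real.exp_pos _).le
    _ = Real.exp m * ∏ i, ∑ k ∈ T i, Real.exp (-(|(k : ℝ)| / ρ)) := by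
        rw [Finset.prod_univ_sum, Finset.mul_sum]
        refine Finset.sum_congr rfl fun g _ => ?_
        rw [← Real.exp_sum, ← Real.exp_add, Finset.sum_neg_distrib, ← Finset.sum_div]
        ring_nf
    _ ≤ Real.exp m * (4 * ρ) ^ m := by
        gcongr
        rw [← Finset.prod_mul_prod_compl A]
        have h1 : ∏ i ∈ A, ∑ k ∈ T i, Real.exp (-(|(k : ℝ)| / ρ)) = 1 :=
          Finset.prod_eq_one fun i hi => by simp [T, hi]
        rw [h1, one_mul, ← hA, ← Finset.prod_const]
        refine Finset.prod_le_prod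
          (fun i _ => Finset.sum_nonneg fun _ _ => (Real.exp_pos _).le) fun i hi => ?_
        simp only [T, Finset.mem_compl.1 hi, if_false]
        exact sum_Icc_exp_neg_abs_le _ hρ
    _ = _ := by rw [mul_pow (Real.exp 1), ← Real.exp_nat_mul, mul_one]

theorem choose_le_exp_mul_div_pow {n m : ℕ} (hm : 0 < m) :
    (n.choose m : ℝ) ≤ (Real.exp 1 * (n / m)) ^ m := by
  have hm' : (0 : ℝ) < m := by exact_mod_cast hm
  have h1 := Nat.choose_le_pow_div (α := ℝ) m n
  have h2 := Real.pow_div_factorial_le_exp (m : ℝ) hm'.le m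
  have hf : (0 : ℝ) < m.factorial := by exact_mod_cast m.factorial_pos
  refine h1.trans ?_
  rw [div_le_iff₀ hf]
  rw [div_le_iff₀ hf] at h2
  calc (n : ℝ) ^ m = (n / m) ^ m * (m : ℝ) ^ m := by rw [← mul_pow]; field_simp
    _ ≤ (n / m) ^ m * (Real.exp m * m.factorial) := by gcongr
    _ = _ := by rw [mul_pow, ← Real.exp_nat_mul, mul_one]; ring

/-! ### Discretization -/

section Net

variable {n : ℕ} {p : ℝ}

/-- The net points are representatives taken from `S` itself, so the bound for single vectors of `S`
applies to them without any loss from rounding. -/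
theorem matP_net_le (h0 : 0 ≤ p) (h1 : p ≤ 1) {κ : Type*} (K : Finset κ)
    (S : Set (EuclideanSpace ℝ (Fin n))) (G : Set (Fin n → Fin n → Bool))
    (Rel : κ → EuclideanSpace ℝ (Fin n) → Prop) {a q : ℝ} (hq : 0 ≤ q)
    (hcov : ∀ x ∈ S, ∃ k ∈ K, Rel k x)
    (hclose : ∀ k x y, Rel k x → Rel k y → ∀ b ∈ G, ‖mv b (x - y)‖ ≤ a)
    (hsingle : ∀ x ∈ S, matP p {b | ‖mv b x‖ ≤ 2 * a} ≤ q) :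
    matP p (G ∩ {b | ∃ x ∈ S, ‖mv b x‖ < a}) ≤ K.card * q := by
  have hsub : G ∩ {b | ∃ x ∈ S, ‖mv b x‖ < a} ⊆
      ⋃ k ∈ K, (G ∩ {b | ∃ x ∈ S, Rel k x ∧ ‖mv b x‖ < a}) := by
    rintro b ⟨hb, x, hx, hlt⟩
    obtain ⟨k, hk, hR⟩ := hcov x hx
    simp only [Set.mem_iUnion]
    exact ⟨k, hk, hb, x, hx, hR, hlt⟩
  refine (matP_mono h0 h1 hsub).trans (matP_biUnion_le h0 h1 K _ fun k _ => ?_)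
  by_cases hne : ∃ y ∈ S, Rel k y
  · obtain ⟨y, hy, hRy⟩ := hne
    refine (matP_mono h0 h1 ?_).trans (hsingle y hy)
    rintro b ⟨hb, x, hx, hR, hlt⟩
    have h := hclose k y x hRy hR b hb
    have e : mv b y = mv b (y - x) + mv b x := by rw [mv_sub]; abel
    have := norm_add_le (mv b (y - x)) (mv b x)
    rw [← e] at this
    change ‖mv b y‖ ≤ 2 * a
    linarith
  · have : G ∩ {b | ∃ x ∈ S, Rel k x ∧ ‖mv b x‖ < a} = ∅ := by
      ext b
      simp only [Set.mem_inter_iff, Set.mem_empty_iff_false, iff_false]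
      rintro ⟨_, x, hx, hR, _⟩
      exact hne ⟨x, hx, hR⟩
    rw [this]; simpa [matP] using hq

/-- Matrices whose centered version is bounded on the cube. -/
def cubeBounded (n : ℕ) (p : ℝ) : Set (Fin n → Fin n → Bool) :=
  {b | ∀ ε : Fin n → Bool, ∑ i, (∑ j, (bv (b i j) - p) * sg (ε j)) ^ 2 ≤ 648 * p * n ^ 2}

theorem abs_sub_le_of_floor_div_eq {u v δ : ℝ} (hδ : 0 < δ) (h : ⌊u / δ⌋ = ⌊v / δ⌋) :
    |u - v| ≤ δ := by
  have := (Int.abs_sub_lt_one_of_floor_eq_floor h).le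
  rwa [← sub_div, abs_div, abs_of_pos hδ, div_le_one hδ] at this

theorem floor_div_mem_Icc {u δ V : ℝ} {B : ℕ} (hδ : 0 < δ) (hu : |u| ≤ V) (hB : V / δ + 1 ≤ B) :
    ⌊u / δ⌋ ∈ Finset.Icc (-(B : ℤ)) B := by
  have h1 : |u / δ| ≤ V / δ := by rw [abs_div, abs_of_pos hδ]; gcongr
  have h2 := abs_le.1 h1
  have h3 := Int.floor_le (u / δ)
  have h4 := Int.lt_floor_add_one (u / δ)
  rw [Finset.mem_Icc]
  constructor
  · have : (-(B : ℝ)) ≤ ⌊u / δ⌋ := by linarith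
    exact_mod_cast this
  · have : (⌊u / δ⌋ : ℝ) ≤ B := by linarith
    exact_mod_cast this

theorem abs_floor_le (t : ℝ) : |(⌊t⌋ : ℝ)| ≤ |t| + 1 := by
  have h3 := Int.floor_le t
  have h4 := Int.lt_floor_add_one t
  have h5 := le_abs_self t
  have h6 := neg_abs_le t
  exact abs_le.2 ⟨by linarith, by linarith⟩

/-- `x` lies in the cell with key `k`: a flat set of coordinates, one exceptional coordinate, and
the rounded values of the flat level, of the exceptional coordinate, of the sum of the
coordinates, and of the remaining coordinates. -/
def InCell (w δ δ' : ℝ)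
    (k : (_ : Finset (Fin n)) × (Fin n → ℤ)) (l : Fin n × ℤ × ℤ × ℤ)
    (x : EuclideanSpace ℝ (Fin n)) : Prop :=
  (∃ t : ℝ, (∀ i ∈ k.1, |x i - t| ≤ w) ∧ ⌊t / δ⌋ = l.2.1) ∧ ⌊x l.1 / δ⌋ = l.2.2.1 ∧
    ⌊(∑ i, x i) / δ'⌋ = l.2.2.2 ∧ ∀ i, i ∉ k.1 → i ≠ l.1 → ⌊x i / δ⌋ = k.2 i

theorem InCell.abs_sub_le {w δ δ' : ℝ} (hw : 0 ≤ w) (hδ : 0 < δ) (hδ' : 0 < δ')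
    {k : (_ : Finset (Fin n)) × (Fin n → ℤ)} {l : Fin n × ℤ × ℤ × ℤ}
    {x y : EuclideanSpace ℝ (Fin n)} (hx : InCell w δ δ' k l x) (hy : InCell w δ δ' k l y) :
    (∀ i, |(x - y) i| ≤ 2 * w + δ) ∧ |∑ i, (x - y) i| ≤ δ' := by
  obtain ⟨⟨t, hxt, hxt'⟩, hx1, hx2, hx3⟩ := hx
  obtain ⟨⟨u, hyu, hyu'⟩, hy1, hy2, hy3⟩ := hy
  refine ⟨fun i => ?_, ?_⟩
  · rw [PiLp.sub_apply]
    by_cases hi : i = l.1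
    · subst hi
      have := abs_sub_le_of_floor_div_eq hδ (hx1.trans hy1.symm)
      linarith
    by_cases hk : i ∈ k.1
    · have h1 := abs_le.1 (abs_sub_le_of_floor_div_eq hδ (hxt'.trans hyu'.symm))
      have h2 := abs_le.1 (hxt i hk)
      have h3 := abs_le.1 (hyu i hk)
      exact abs_le.2 ⟨by linarith, by linarith⟩
    · have := abs_sub_le_of_floor_div_eq hδ ((hx3 i hk hi).trans (hy3 i hk hi).symm)
      linarith
  · have := abs_sub_le_of_floor_div_eq hδ' (hx2.trans hy2.symm)
    simpa [Finset.sum_sub_distrib] using this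

/-- Cell keys: the numbers are bounded by `B`, and the rounded vector has small `ℓ₁`-norm. -/
noncomputable def cellKeys (n m B : ℕ) (ρ : ℝ) :
    Finset (((_ : Finset (Fin n)) × (Fin n → ℤ)) × (Fin n × ℤ × ℤ × ℤ)) :=
  ((Finset.powersetCard (n - m) Finset.univ).sigma fun A => latticeBall A (m * ρ)) ×ˢ
    (Finset.univ ×ˢ Finset.Icc (-(B : ℤ)) B ×ˢ Finset.Icc (-(B : ℤ)) B ×ˢ Finset.Icc (-(B : ℤ)) B)

theorem card_cellKeys_le {n m B : ℕ} (hm : 0 < m) (hmn : m ≤ n) {ρ : ℝ} (hρ : 1 ≤ ρ) :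
    ((cellKeys n m B ρ).card : ℝ) ≤
      (Real.exp 1 * (n / m) * (Real.exp 1 * (4 * ρ))) ^ m * (n * (2 * B + 1) ^ 3) := by
  rw [cellKeys, Finset.card_product, Finset.card_product, Finset.card_product,
    Finset.card_product, Finset.card_sigma, Int.card_Icc, Finset.card_univ, Fintype.card_fin]
  have e : ((B : ℤ) + 1 - -(B : ℤ)).toNat = 2 * B + 1 := by omega
  rw [e]
  have h1 : ((∑ A ∈ Finset.powersetCard (n - m) (Finset.univ : Finset (Fin n)),
      (latticeBall A (m * ρ)).card : ℕ) : ℝ) ≤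
      (Real.exp 1 * (n / m) * (Real.exp 1 * (4 * ρ))) ^ m := by
    push_cast
    calc ∑ A ∈ Finset.powersetCard (n - m) (Finset.univ : Finset (Fin n)),
          ((latticeBall A (m * ρ)).card : ℝ)
        ≤ ∑ A ∈ Finset.powersetCard (n - m) (Finset.univ : Finset (Fin n)),
          (Real.exp 1 * (4 * ρ)) ^ m := by
          refine Finset.sum_le_sum fun A hA => card_latticeBall_le A ?_ hρ
          rw [Finset.card_compl, (Finset.mem_powersetCard.1 hA).2, Fintype.card_fin]
          omega
      _ = (n.choose m : ℝ) * (Real.exp 1 * (4 * ρ)) ^ m := by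
          rw [Finset.sum_const, Finset.card_powersetCard, Finset.card_univ, Fintype.card_fin,
            Nat.choose_symm hmn, nsmul_eq_mul]
      _ ≤ _ := by
          rw [mul_pow (Real.exp 1 * (n / m))]
          gcongr
          exact choose_le_exp_mul_div_pow hm
  rw [Nat.cast_mul]
  refine (mul_le_mul_of_nonneg_right h1 (Nat.cast_nonneg _)).trans_eq ?_
  push_cast
  ring

theorem exists_cellKey {m B : ℕ} (hm : 0 < m) (hmn : m ≤ n) {γ c₀ c₂ R : ℝ} (hγ : 0 < γ)
    (hc₂ : 0 < c₂) (hR : 0 ≤ R) (hp : 0 < p) (hp1 : p ≤ 1)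
    (hB : 2 / (c₂ * γ / Real.sqrt n) + 1 ≤ B)
    {x : EuclideanSpace ℝ (Fin n)} (hx1 : ‖x‖ ≤ 1) (hU : x ∈ U n m (c₀ * γ)) {j : Fin n}
    (hj : ∑ i ∈ Finset.univ.erase j, x i ^ 2 ≤ (R * γ) ^ 2) :
    ∃ k ∈ cellKeys n m B (1 + R / c₂ * Real.sqrt (n / m)),
      InCell (c₀ * γ / Real.sqrt n) (c₂ * γ / Real.sqrt n) (c₂ * γ / Real.sqrt p) k.1 k.2 x := by
  classical
  have hm' : (0 : ℝ) < m := by exact_mod_cast hm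
  have hn1 : (1 : ℝ) ≤ n := by exact_mod_cast (by omega : 1 ≤ n)
  have hn' : (0 : ℝ) < n := by linarith
  set δ := c₂ * γ / Real.sqrt n with hδdef
  set δ' := c₂ * γ / Real.sqrt p with hδ'def
  have hδ : 0 < δ := by positivity
  have hδ' : 0 < δ' := by positivity
  -- The coordinate sum can be as large as `√n`, but it is rounded at the coarser scale `δ'`, so the
  -- same `B` serves all three numbers.
  have hδδ' : Real.sqrt n / δ' ≤ 2 / δ := by
    have h1 : Real.sqrt p ≤ 1 := Real.sqrt_le_one.2 hp1
    have h2 : 0 < Real.sqrt p := Real.sqrt_pos.2 hp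
    have h3 : 0 < Real.sqrt n := Real.sqrt_pos.2 hn'
    rw [div_le_div_iff₀ hδ' hδ, hδdef, hδ'def, mul_div_cancel₀ _ h3.ne', ← mul_div_assoc,
      le_div_iff₀ h2]
    nlinarith [mul_pos hc₂ hγ]
  obtain ⟨A, hA, t, ht, hAt⟩ := hU
  have hsq : ∑ i, x i ^ 2 ≤ 1 := by
    have := EuclideanSpace.norm_sq_eq x
    simp only [Real.norm_eq_abs, sq_abs] at this
    rw [← this]; exact pow_le_one₀ (norm_nonneg _) hx1
  have hxi : ∀ i, |x i| ≤ 1 := by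
    intro i
    have h1 : x i ^ 2 ≤ 1 := (Finset.single_le_sum (f := fun i => x i ^ 2)
      (fun _ _ => sq_nonneg _) (Finset.mem_univ i)).trans hsq
    exact abs_le_of_sq_le_sq (by rwa [one_pow]) zero_le_one
  have hsum : |∑ i, x i| ≤ Real.sqrt n := by
    refine Real.abs_le_sqrt ?_
    have := sq_sum_le_card_mul_sum_sq (s := Finset.univ) (f := fun i => x i)
    rw [Finset.card_univ, Fintype.card_fin] at this
    nlinarith
  have ht2 : |t| ≤ 2 := by
    refine ht.trans ?_
    have : 1 ≤ Real.sqrt m := Real.one_le_sqrt.2 (by exact_mod_cast hm)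
    rw [div_le_iff₀ (by linarith)]
    linarith
  -- Coordinate `j` is recorded separately: it may be of order `1` at a tiny level `γ`, and only the
  -- others have `ℓ₂`-norm at most `Rγ`.
  set g : Fin n → ℤ := fun i => if i ∈ A ∨ i = j then 0 else ⌊x i / δ⌋
  have hAc : Aᶜ.card = m := by
    rw [Finset.card_compl, hA, Fintype.card_fin]; omega
  have hg : ∑ i, |(g i : ℝ)| ≤ m * (1 + R / c₂ * Real.sqrt (n / m)) := by
    have h1 : ∑ i, |(g i : ℝ)| ≤ ∑ i ∈ Aᶜ.erase j, (|x i| / δ + 1) := by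
      rw [← Finset.sum_subset (Finset.subset_univ (Aᶜ.erase j))]
      · refine Finset.sum_le_sum fun i hi => ?_
        rw [Finset.mem_erase, Finset.mem_compl] at hi
        simp only [g, hi.1, hi.2, or_self, if_false]
        refine (abs_floor_le _).trans_eq ?_
        rw [abs_div, abs_of_pos hδ]
      · intro i _ hi
        have : i ∈ A ∨ i = j := by
          by_contra hcon
          push Not at hcon
          exact hi (Finset.mem_erase.2 ⟨hcon.2, Finset.mem_compl.2 hcon.1⟩)
        simp [g, this]
    have hcard : ((Aᶜ.erase j).card : ℝ) ≤ m := by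
      rw [← hAc]; exact_mod_cast Finset.card_erase_le
    have h2 : ∑ i ∈ Aᶜ.erase j, |x i| ≤ Real.sqrt m * (R * γ) := by
      refine le_of_sq_le_sq ?_ (by positivity)
      have := sq_sum_le_card_mul_sum_sq (s := Aᶜ.erase j) (f := fun i => |x i|)
      simp only [sq_abs] at this
      rw [mul_pow, Real.sq_sqrt hm'.le]
      refine this.trans (mul_le_mul hcard ?_ (Finset.sum_nonneg fun _ _ => sq_nonneg _) hm'.le)
      exact (Finset.sum_le_sum_of_subset_of_nonneg
        (Finset.erase_subset_erase _ (Finset.subset_univ _)) fun _ _ _ => sq_nonneg _).trans hj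
    refine h1.trans ?_
    rw [Finset.sum_add_distrib, ← Finset.sum_div]
    have h3 : (∑ i ∈ Aᶜ.erase j, |x i|) / δ ≤ Real.sqrt m * (R * γ) / δ := by gcongr
    have h4 : Real.sqrt m * (R * γ) / δ = m * (R / c₂ * Real.sqrt (n / m)) := by
      rw [Real.sqrt_div hn'.le, hδdef]
      have := Real.sqrt_pos.2 hm'
      field_simp
      rw [Real.sq_sqrt hm'.le]
      ring
    simp only [Finset.sum_const, nsmul_eq_mul, mul_one]
    linarith
  have hV : ∀ u : ℝ, |u| ≤ 2 → ⌊u / δ⌋ ∈ Finset.Icc (-(B : ℤ)) B := fun u hu =>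
    floor_div_mem_Icc hδ hu hB
  refine ⟨(⟨A, g⟩, (j, ⌊t / δ⌋, ⌊x j / δ⌋, ⌊(∑ i, x i) / δ'⌋)), ?_, ⟨t, hAt, rfl⟩, rfl, rfl, ?_⟩
  · simp only [cellKeys, Finset.mem_product, Finset.mem_sigma, Finset.mem_powersetCard,
      Finset.mem_univ, true_and]
    refine ⟨⟨⟨Finset.subset_univ _, hA⟩, mem_latticeBall (fun i hi => by simp [g, hi]) hg⟩,
      hV _ ht2, hV _ ((hxi j).trans one_le_two), ?_⟩
    refine floor_div_mem_Icc hδ' hsum (le_trans ?_ hB)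
    gcongr
  · intro i hi hij
    simp [g, hi, hij]

/-- Union bound over the cells of a family of vectors which are flat at level `γ`. -/
theorem matP_exists_small_le {m B : ℕ} (hm : 0 < m) (hmn : m ≤ n) {γ c₀ c₂ R q : ℝ} (hγ : 0 < γ)
    (hc₀ : 0 < c₀) (hc₂ : 0 < c₂) (hsmall : 52 * c₀ + 27 * c₂ ≤ 1 / 80) (hR : 0 ≤ R) (hp : 0 < p)
    (hp1 : p ≤ 1) (hB : 2 / (c₂ * γ / Real.sqrt n) + 1 ≤ B)
    {S : Set (EuclideanSpace ℝ (Fin n))} (hS1 : ∀ x ∈ S, ‖x‖ ≤ 1)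
    (hSU : ∀ x ∈ S, x ∈ U n m (c₀ * γ))
    (hSj : ∀ x ∈ S, ∃ j, ∑ i ∈ Finset.univ.erase j, x i ^ 2 ≤ (R * γ) ^ 2) (hq : 0 ≤ q)
    (hsingle : ∀ x ∈ S, matP p {b | ‖mv b x‖ ≤ 1 / 40 * γ * Real.sqrt (p * n)} ≤ q) :
    matP p (cubeBounded n p ∩ {b | ∃ x ∈ S, ‖mv b x‖ < 1 / 80 * γ * Real.sqrt (p * n)}) ≤
      (cellKeys n m B (1 + R / c₂ * Real.sqrt (n / m))).card * q := by
  have hn' : (0 : ℝ) < n := by exact_mod_cast (by omega : 0 < n)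
  refine matP_net_le hp.le hp1 _ S _ (fun k x => InCell (c₀ * γ / Real.sqrt n)
    (c₂ * γ / Real.sqrt n) (c₂ * γ / Real.sqrt p) k.1 k.2 x) hq ?_ ?_ ?_
  · intro x hx
    obtain ⟨j, hj⟩ := hSj x hx
    exact exists_cellKey hm hmn hγ hc₂ hR hp hp1 hB (hS1 x hx) (hSU x hx) hj
  · intro k x y hkx hky b hb
    have hw : 0 ≤ c₀ * γ / Real.sqrt n := by positivity
    have hsn := Real.sqrt_pos.2 hn'
    have hsp := Real.sqrt_pos.2 hp
    obtain ⟨h1, h2⟩ := hkx.abs_sub_le hw (by positivity) (by positivity) hky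
    refine (norm_mv_le hp.le hb (by positivity) h1).trans ?_
    calc 26 * Real.sqrt p * n * (2 * (c₀ * γ / Real.sqrt n) + c₂ * γ / Real.sqrt n) +
          p * Real.sqrt n * |∑ i, (x - y) i|
        ≤ 26 * Real.sqrt p * n * (2 * (c₀ * γ / Real.sqrt n) + c₂ * γ / Real.sqrt n) +
          p * Real.sqrt n * (c₂ * γ / Real.sqrt p) := by gcongr
      _ = (52 * c₀ + 27 * c₂) * (γ * (Real.sqrt p * Real.sqrt n)) := by
          have e1 : (n : ℝ) = Real.sqrt n * Real.sqrt n := (Real.mul_self_sqrt hn'.le).symm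
          have e2 : p = Real.sqrt p * Real.sqrt p := (Real.mul_self_sqrt hp.le).symm
          have e3 : 26 * Real.sqrt p * n * (2 * (c₀ * γ / Real.sqrt n) + c₂ * γ / Real.sqrt n) =
              26 * Real.sqrt p * (2 * (c₀ * γ) + c₂ * γ) * Real.sqrt n := by
            nth_rewrite 1 [e1]; field_simp
          have e4 : p * Real.sqrt n * (c₂ * γ / Real.sqrt p) =
              Real.sqrt p * Real.sqrt n * (c₂ * γ) := by
            nth_rewrite 1 [e2]; field_simp
          rw [e3, e4]; ring
      _ ≤ 1 / 80 * (γ * (Real.sqrt p * Real.sqrt n)) := by gcongr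
      _ = _ := by rw [Real.sqrt_mul hp.le]; ring
  · intro x hx
    refine le_trans (le_of_eq ?_) (hsingle x hx)
    congr 1; ext b
    have : 2 * (1 / 80 * γ * Real.sqrt (p * n)) = 1 / 40 * γ * Real.sqrt (p * n) := by ring
    simp only [Set.mem_ofPred_eq, this]

end Net

/-! ### Size of the net -/

/-- The constant in the upper bound on the sparsity `m`. -/
noncomputable def sparsityConst (C₀ : ℝ) : ℝ := (1 / (200 * Real.log (10 ^ 6 * C₀))) ^ 2

theorem one_le_log_million_mul {C₀ : ℝ} (hC₀ : 1 ≤ C₀) : 1 ≤ Real.log (10 ^ 6 * C₀) := by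
  rw [Real.le_log_iff_exp_le (by positivity)]
  have := Real.exp_one_lt_d9
  nlinarith

theorem sparsityConst_pos {C₀ : ℝ} (hC₀ : 1 ≤ C₀) : 0 < sparsityConst C₀ := by
  have := one_le_log_million_mul hC₀
  unfold sparsityConst; positivity

theorem log_exp_one_div {p : ℝ} (h0 : 0 < p) : Real.log (Real.exp 1 / p) = 1 - Real.log p := by
  rw [Real.log_div (Real.exp_pos 1).ne' h0.ne', Real.log_exp]

theorem one_le_log_exp_one_div {p : ℝ} (h0 : 0 < p) (h1 : p ≤ 1) :
    1 ≤ Real.log (Real.exp 1 / p) := by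
  rw [log_exp_one_div h0]
  linarith [Real.log_nonpos h0.le h1]

/-- With `y = pn/m`, the logarithm of the base is `G + 2 log y + 4(L - 1)`. The sparsity condition
says `L ≤ d²y`; since `L ≥ 1`, this makes `y` large enough that each of the three terms is a small
multiple of `y`. -/
theorem net_entropy_le {C₀ p : ℝ} {n m : ℕ} (hC₀ : 1 ≤ C₀) (h0 : 0 < p) (h1 : p ≤ 1) (hm : 0 < m)
    (hn : 0 < n) (hmc : (m : ℝ) ≤ sparsityConst C₀ * p * n / Real.log (Real.exp 1 / p)) :
    (10 ^ 6 * C₀ * (n / (m * p)) ^ 2) ^ m ≤ Real.exp (0.05 * (p * n)) := by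
  have hm' : (0 : ℝ) < m := by exact_mod_cast hm
  have hn' : (0 : ℝ) < n := by exact_mod_cast hn
  have hG := one_le_log_million_mul hC₀
  set G := Real.log (10 ^ 6 * C₀)
  set L := Real.log (Real.exp 1 / p)
  have hL : 1 ≤ L := one_le_log_exp_one_div h0 h1
  set d := 1 / (200 * G) with hd
  have hd0 : 0 < d := by positivity
  have hdG : d * G = 1 / 200 := by rw [hd]; field_simp
  have hc : sparsityConst C₀ = d ^ 2 := rfl
  set y := p * n / m with hy
  have hy0 : 0 < y := by positivity
  have hLy : L ≤ d ^ 2 * y := by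
    rw [hc, le_div_iff₀ (by linarith)] at hmc
    rw [hy, ← mul_div_assoc, le_div_iff₀ hm']
    nlinarith
  have hdy : 1 ≤ d * Real.sqrt y := by
    rw [← abs_of_pos (by positivity : 0 < d * Real.sqrt y), ← one_le_sq_iff_one_le_abs, mul_pow,
      Real.sq_sqrt hy0.le]
    linarith
  have hsy : Real.sqrt y ≤ d * y := by
    have := Real.mul_self_sqrt hy0.le
    have h3 := Real.sqrt_pos.2 hy0
    nlinarith
  have hlogy : Real.log y ≤ 2 * Real.sqrt y := by
    have h3 := Real.log_le_sub_one_of_pos (Real.sqrt_pos.2 hy0)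
    rw [Real.log_sqrt hy0.le] at h3
    linarith
  have hbase : Real.log (10 ^ 6 * C₀ * (n / (m * p)) ^ 2) = G + 2 * (Real.log y + 2 * (L - 1)) := by
    have e : (n : ℝ) / (m * p) = y / p ^ 2 := by rw [hy]; field_simp
    rw [Real.log_mul (by positivity) (by positivity), Real.log_pow, e,
      Real.log_div hy0.ne' (by positivity), Real.log_pow]
    simp only [L, log_exp_one_div h0]
    push_cast; ring
  have hfin : G + 2 * (Real.log y + 2 * (L - 1)) ≤ 0.05 * y := by
    have h2 : G ≤ d ^ 2 * y * G := by nlinarith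
    have h3 : d ^ 2 * y * G = d * y / 200 := by
      calc d ^ 2 * y * G = d * y * (d * G) := by ring
        _ = _ := by rw [hdG]; ring
    have hd1 : d ≤ 1 / 200 := by nlinarith
    have h4 : d * y ≤ y / 200 := by nlinarith
    have h5 : d ^ 2 * y ≤ y / 40000 := by nlinarith
    linarith
  have hpos : 0 < 10 ^ 6 * C₀ * ((n : ℝ) / (m * p)) ^ 2 := by positivity
  rw [← Real.exp_log hpos, ← Real.exp_nat_mul, hbase]
  refine Real.exp_le_exp.2 ?_
  calc (m : ℝ) * (G + 2 * (Real.log y + 2 * (L - 1))) ≤ m * (0.05 * y) := by gcongr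
    _ = _ := by rw [hy]; field_simp

theorem net_base_le {C₀ p : ℝ} {n m : ℕ} (hC₀ : 1 ≤ C₀) (h0 : 0 < p) (h1 : p ≤ 1) (hm : 0 < m)
    (hmn : m ≤ n) :
    Real.exp 1 * ((n : ℝ) / m) * (Real.exp 1 *
      (4 * (1 + 3 * C₀ / Real.sqrt p / (1 / 5000) * Real.sqrt (n / m)))) ≤
      10 ^ 6 * C₀ * (n / (m * p)) ^ 2 := by
  have hm' : (0 : ℝ) < m := by exact_mod_cast hm
  have hmn' : (m : ℝ) ≤ n := by exact_mod_cast hmn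
  have hn' : (0 : ℝ) < n := by linarith
  set Y := (n : ℝ) / (m * p) with hY
  have hY1 : 1 ≤ Y := by
    rw [hY, one_le_div (by positivity)]; nlinarith
  have hnm : (n : ℝ) / m ≤ Y := by
    have : (n : ℝ) / m = Y * p := by rw [hY]; field_simp
    rw [this]; nlinarith
  have hs : 3 * C₀ / Real.sqrt p / (1 / 5000) * Real.sqrt (n / m) = 15000 * C₀ * Real.sqrt Y := by
    have e : Y = (n / m) / p := by rw [hY]; field_simp
    rw [e, Real.sqrt_div (show 0 ≤ (n : ℝ) / m by positivity) p]
    have := Real.sqrt_pos.2 h0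
    field_simp; norm_num
  have hsY : Real.sqrt Y ≤ Y := by
    rw [Real.sqrt_le_left (by linarith)]; nlinarith
  have he := Real.exp_one_lt_d9
  have he2 : Real.exp 1 * Real.exp 1 ≤ 9 := by nlinarith [Real.exp_pos 1]
  rw [hs]
  have hin : 1 + 15000 * C₀ * Real.sqrt Y ≤ 15001 * C₀ * Y := by
    have : C₀ * Real.sqrt Y ≤ C₀ * Y := by gcongr
    have : 1 ≤ C₀ * Y := by nlinarith
    linarith
  calc Real.exp 1 * ((n : ℝ) / m) * (Real.exp 1 * (4 * (1 + 15000 * C₀ * Real.sqrt Y)))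
      = (Real.exp 1 * Real.exp 1) * (((n : ℝ) / m) * (4 * (1 + 15000 * C₀ * Real.sqrt Y))) := by
        ring
    _ ≤ 9 * (Y * (4 * (15001 * C₀ * Y))) := by gcongr
    _ = 540036 * C₀ * Y ^ 2 := by ring
    _ ≤ _ := by gcongr; norm_num

/-- The common union bound for `B₂` and each level of `B₃` and `B₄`. The lower bound on `γ` is the
bottom rung of the `μ` ladder; it keeps the rounded numbers polynomial in `n` and fixes the
threshold `1/(480 C₀ √n)`. -/
theorem matP_level_le {C₀ c₀ γ p : ℝ} {n m : ℕ} (hC₀ : 1 ≤ C₀) (hc₀ : 0 < c₀)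
    (hc₀' : c₀ ≤ 1 / 10000) (hm : 0 < m) (hmn : m ≤ n) (h0 : 0 < p) (h1 : p ≤ 1)
    (hmc : (m : ℝ) ≤ sparsityConst C₀ * p * n / Real.log (Real.exp 1 / p))
    (hγ : 1 / (6 * C₀ * Real.sqrt p * n) ≤ γ)
    {S : Set (EuclideanSpace ℝ (Fin n))} (hS1 : ∀ x ∈ S, ‖x‖ ≤ 1)
    (hSU : ∀ x ∈ S, x ∈ U n m (c₀ * γ))
    (hSj : ∀ x ∈ S, ∃ j, ∑ i ∈ Finset.univ.erase j, x i ^ 2 ≤ (3 * C₀ / Real.sqrt p * γ) ^ 2)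
    (hsingle : ∀ x ∈ S, matP p {b | ‖mv b x‖ ≤ 1 / 40 * γ * Real.sqrt (p * n)} ≤
      Real.exp (-(1.85 * (p * n)))) :
    matP p (cubeBounded n p ∩ {b | ∃ x ∈ S, ‖mv b x‖ < 1 / (480 * C₀ * Real.sqrt n)}) ≤
      10 ^ 18 * C₀ ^ 3 * n ^ 7 * Real.exp (-(1.8 * (p * n))) := by
  have hm' : (0 : ℝ) < m := by exact_mod_cast hm
  have hn1 : (1 : ℝ) ≤ n := by exact_mod_cast (by omega : 1 ≤ n)
  have hn' : (0 : ℝ) < n := by linarith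
  have hsp := Real.sqrt_pos.2 h0
  have hsn := Real.sqrt_pos.2 hn'
  have hγ0 : 0 < γ := lt_of_lt_of_le (by positivity) hγ
  set B : ℕ := ⌈2 / (1 / 5000 * γ / Real.sqrt n) + 1⌉₊
  have hB1 : 2 / (1 / 5000 * γ / Real.sqrt n) + 1 ≤ B := Nat.le_ceil _
  have hB2 : 2 * (B : ℝ) + 1 ≤ 10 ^ 6 * C₀ * n ^ 2 := by
    have h2 : (B : ℝ) < 2 / (1 / 5000 * γ / Real.sqrt n) + 1 + 1 := Nat.ceil_lt_add_one (by positivity)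
    have h3 : 1 / γ ≤ 6 * C₀ * n := by
      rw [div_le_iff₀ (by positivity)] at hγ
      rw [div_le_iff₀ hγ0]
      have : Real.sqrt p ≤ 1 := Real.sqrt_le_one.2 h1
      calc 1 ≤ γ * (6 * C₀ * Real.sqrt p * n) := hγ
        _ ≤ γ * (6 * C₀ * 1 * n) := by gcongr
        _ = _ := by ring
    have h4 : Real.sqrt n ≤ n := by rw [Real.sqrt_le_left (by linarith)]; nlinarith
    have h5 : 2 / (1 / 5000 * γ / Real.sqrt n) = 10000 * Real.sqrt n * (1 / γ) := by
      field_simp; norm_num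
    have h6 : 10000 * Real.sqrt n * (1 / γ) ≤ 10000 * n * (6 * C₀ * n) := by gcongr
    have h7 : 1 ≤ C₀ * (n : ℝ) ^ 2 := one_le_mul_of_one_le_of_one_le hC₀ (one_le_pow₀ hn1)
    nlinarith
  -- With rounding constant `1/5000` and `c₀ ≤ 1/10000`, `52c₀ + 27/5000 ≤ 0.0106 < 1/80`.
  have h := matP_exists_small_le hm hmn hγ0 hc₀ (by norm_num : (0 : ℝ) < 1 / 5000) (by linarith)
    (by positivity : 0 ≤ 3 * C₀ / Real.sqrt p) h0 h1 hB1 hS1 hSU hSj (Real.exp_pos _).le hsingle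
  have hthr : 1 / (480 * C₀ * Real.sqrt n) ≤ 1 / 80 * γ * Real.sqrt (p * n) := by
    rw [Real.sqrt_mul h0.le]
    calc 1 / (480 * C₀ * Real.sqrt n) =
          1 / 80 * (1 / (6 * C₀ * Real.sqrt p * n)) * (Real.sqrt p * Real.sqrt n) := by
          have e1 : (n : ℝ) = Real.sqrt n * Real.sqrt n := (Real.mul_self_sqrt hn'.le).symm
          nth_rewrite 2 [e1]; field_simp; norm_num
      _ ≤ _ := by gcongr
  refine (matP_mono h0.le h1 ?_).trans (h.trans ?_)
  · rintro b ⟨hb, x, hx, hlt⟩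
    exact ⟨hb, x, hx, hlt.trans_le hthr⟩
  have hK := card_cellKeys_le (B := B) hm hmn
    (show 1 ≤ 1 + 3 * C₀ / Real.sqrt p / (1 / 5000) * Real.sqrt (n / m) from
      le_add_of_nonneg_right (by positivity))
  calc _ ≤ (Real.exp 1 * ((n : ℝ) / m) * (Real.exp 1 *
        (4 * (1 + 3 * C₀ / Real.sqrt p / (1 / 5000) * Real.sqrt (n / m))))) ^ m *
        (n * (2 * B + 1) ^ 3) * Real.exp (-(1.85 * (p * n))) := by gcongr
    _ ≤ (10 ^ 6 * C₀ * (n / (m * p)) ^ 2) ^ m *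
        (n * (10 ^ 6 * C₀ * n ^ 2) ^ 3) * Real.exp (-(1.85 * (p * n))) := by
        have := net_base_le hC₀ h0 h1 hm hmn
        gcongr ?_ ^ m * (n * ?_ ^ 3) * _
    _ ≤ Real.exp (0.05 * (p * n)) *
        (n * (10 ^ 6 * C₀ * n ^ 2) ^ 3) * Real.exp (-(1.85 * (p * n))) := by
        gcongr
        exact net_entropy_le hC₀ h0 h1 hm (by omega) hmc
    _ = 10 ^ 18 * C₀ ^ 3 * n ^ 7 *
        (Real.exp (0.05 * (p * n)) * Real.exp (-(1.85 * (p * n)))) := by ring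
    _ = _ := by rw [← Real.exp_add]; congr 2; ring

/-! ### Rearrangements and ladders -/

/-- Collects the facts about `star` and `Q` used in the estimates below, so that the sorting
permutation is not needed again. -/
theorem exists_top_two {n : ℕ} (hn : 2 ≤ n) (x : EuclideanSpace ℝ (Fin n)) :
    ∃ j k : Fin n, j ≠ k ∧ star x 1 = |x j| ∧ star x 2 = |x k| ∧ (∀ i, |x i| ≤ star x 1) ∧
      (∀ i, i ≠ j → |x i| ≤ star x 2) ∧
      ‖Q x‖ ^ 2 = ∑ i ∈ Finset.univ.erase j, x i ^ 2 := by
  have hs1 : star x 1 = |x (sortPerm x ⟨0, by omega⟩)| := by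
    rw [star, dif_pos ⟨le_rfl, by omega⟩]
  have hs2 : star x 2 = |x (sortPerm x ⟨1, by omega⟩)| := by
    rw [star, dif_pos ⟨by omega, hn⟩]
  have ha := antitone_abs_sortPerm x
  refine ⟨sortPerm x ⟨0, by omega⟩, sortPerm x ⟨1, by omega⟩, ?_, hs1, hs2, ?_, ?_, ?_⟩
  · rw [Ne, EmbeddingLike.apply_eq_iff_eq]; simp
  · intro i
    rw [hs1]
    have := ha (show (⟨0, by omega⟩ : Fin n) ≤ (sortPerm x).symm i from Nat.zero_le _)
    simpa using this
  · intro i hi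
    rw [hs2]
    have h0 : ((sortPerm x).symm i : ℕ) ≠ 0 := by
      intro h
      apply hi
      rw [← Equiv.symm_apply_eq]
      exact Fin.ext h
    have := ha (show (⟨1, by omega⟩ : Fin n) ≤ (sortPerm x).symm i from by
      rw [Fin.le_def]; exact Nat.one_le_iff_ne_zero.2 h0)
    simpa using this
  · rw [EuclideanSpace.norm_sq_eq, ← Finset.sum_subset (Finset.subset_univ (Finset.univ.erase
      (sortPerm x ⟨0, by omega⟩)))]
    · refine Finset.sum_congr rfl fun i hi => ?_
      have h0 : ((sortPerm x).symm i : ℕ) ≠ 0 := by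
        intro h
        apply Finset.ne_of_mem_erase hi
        rw [← Equiv.symm_apply_eq]
        exact Fin.ext h
      simp [Q, h0]
    · intro i _ hi
      have : i = sortPerm x ⟨0, by omega⟩ := by simpa using hi
      simp [Q, this]

theorem ladder_pos {a : ℝ} (ha : 0 < a) (k : ℕ) : 0 < ladder a k :=
  lt_min (by positivity) one_pos

theorem le_ladder {a : ℝ} (ha : 0 < a) (ha1 : a ≤ 1) (k : ℕ) : a ≤ ladder a k :=
  le_min (le_mul_of_one_le_left ha.le (one_le_pow₀ (by norm_num))) ha1

theorem ladder_succ_le {a : ℝ} {k : ℕ} (hk : 1 ≤ k) : ladder a (k + 1) ≤ 3 * ladder a k := by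
  unfold ladder
  obtain ⟨l, rfl⟩ := Nat.exists_eq_add_of_le hk
  have e : 1 + l + 1 - 1 = (1 + l - 1) + 1 := by omega
  rw [e, pow_succ]
  rcases le_total (3 ^ (1 + l - 1) * a) 1 with h | h
  · rw [min_eq_left h]
    exact (min_le_left _ _).trans (le_of_eq (by ring))
  · rw [min_eq_right h]
    exact (min_le_right _ _).trans (by norm_num)

/-- A crude count of rungs. The true number is logarithmic in `1/a`, but a polynomial factor costs
nothing here. -/
theorem le_inv_of_ladder_lt_one {a : ℝ} (ha : 0 < a) {k : ℕ} (hk : 1 ≤ k) (h : ladder a k < 1) :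
    (k : ℝ) ≤ a⁻¹ := by
  have h1 : 3 ^ (k - 1) * a < 1 := by
    rcases min_lt_iff.1 h with h | h
    · exact h
    · exact absurd h (lt_irrefl _)
  have h2 : k ≤ 3 ^ (k - 1) := by
    have := Nat.lt_pow_self (n := k - 1) (a := 3) (by norm_num)
    omega
  have h3 : (k : ℝ) ≤ 3 ^ (k - 1) := by exact_mod_cast h2
  rw [le_inv_comm₀ (by positivity) ha]
  rw [← one_div, le_div_iff₀ (by positivity)]
  nlinarith

/-! ### The classes of structured vectors -/

theorem U_mono {n m : ℕ} {γ γ' : ℝ} (h : γ ≤ γ') : U n m γ ⊆ U n m γ' := by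
  rintro x ⟨A, hA, t, ht, hx⟩
  exact ⟨A, hA, t, ht, fun i hi => (hx i hi).trans (by gcongr)⟩

theorem bv_nonneg (b : Bool) : 0 ≤ bv b := by unfold bv; split_ifs <;> norm_num

/-- The gap factor `6pn` beats the row sum `5pn`, so one entry of the image survives; no net is
needed for this class. -/
theorem norm_mv_ge_of_mem_B₁ {n : ℕ} {p : ℝ} (hn : 2 ≤ n) {b : Fin n → Fin n → Bool}
    (hcol : ∀ j, ∃ i, b i j = true) (hrow : ∀ i, ∑ j, bv (b i j) ≤ 5 * (p * n))
    {x : EuclideanSpace ℝ (Fin n)} (hx : x ∈ B₁ n p) : 1 / (6 * Real.sqrt n) ≤ ‖mv b x‖ := by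
  obtain ⟨hx1, hx2⟩ := hx
  obtain ⟨j, k, hjk, hs1, hs2, hle1, hle2, -⟩ := exists_top_two hn x
  obtain ⟨i, hi⟩ := hcol j
  have hn' : (0 : ℝ) < n := by exact_mod_cast (by omega : 0 < n)
  have h2 : 0 ≤ star x 2 := by rw [hs2]; exact abs_nonneg _
  have hdot : star x 1 / 6 ≤ |dot (b i) x| := by
    have e : dot (b i) x = x j + ∑ l ∈ Finset.univ.erase j, bv (b i l) * x l := by
      rw [dot, ← Finset.add_sum_erase _ _ (Finset.mem_univ j), hi]; simp [bv]
    have h3 : |∑ l ∈ Finset.univ.erase j, bv (b i l) * x l| ≤ 5 * (p * n) * star x 2 := by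
      calc |∑ l ∈ Finset.univ.erase j, bv (b i l) * x l|
          ≤ ∑ l ∈ Finset.univ.erase j, |bv (b i l) * x l| := Finset.abs_sum_le_sum_abs _ _
        _ ≤ ∑ l ∈ Finset.univ.erase j, bv (b i l) * star x 2 := by
            refine Finset.sum_le_sum fun l hl => ?_
            rw [abs_mul, abs_of_nonneg (bv_nonneg _)]
            exact mul_le_mul_of_nonneg_left (hle2 l (Finset.ne_of_mem_erase hl)) (bv_nonneg _)
        _ ≤ ∑ l, bv (b i l) * star x 2 :=
            Finset.sum_le_sum_of_subset_of_nonneg (Finset.subset_univ _)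
              fun l _ _ => mul_nonneg (bv_nonneg _) h2
        _ ≤ _ := by rw [← Finset.sum_mul]; exact mul_le_mul_of_nonneg_right (hrow i) h2
    have h4 := abs_sub_abs_le_abs_sub (x j) (-∑ l ∈ Finset.univ.erase j, bv (b i l) * x l)
    rw [abs_neg, sub_neg_eq_add, ← e, ← hs1] at h4
    linarith
  have hmv : |dot (b i) x| ≤ ‖mv b x‖ := PiLp.norm_apply_le (mv b x) i
  have hstar : 1 / Real.sqrt n ≤ star x 1 := by
    have h5 := EuclideanSpace.norm_sq_eq x
    simp only [Real.norm_eq_abs] at h5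
    have h0 : 0 ≤ star x 1 := by rw [hs1]; exact abs_nonneg _
    have h6 : ∑ l, |x l| ^ 2 ≤ ∑ l : Fin n, star x 1 ^ 2 :=
      Finset.sum_le_sum fun l _ => pow_le_pow_left₀ (abs_nonneg _) (hle1 l) 2
    rw [← h5, hx1, Finset.sum_const, Finset.card_univ, Fintype.card_fin, nsmul_eq_mul] at h6
    have h7 := Real.sqrt_pos.2 hn'
    rw [div_le_iff₀ h7]
    refine le_of_sq_le_sq ?_ (by positivity)
    rw [mul_pow, Real.sq_sqrt hn'.le]
    linarith
  calc 1 / (6 * Real.sqrt n) = 1 / Real.sqrt n / 6 := by ring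
    _ ≤ ‖mv b x‖ := by linarith

/-! ### Union bounds for the levels of `B₂`, `B₃` and `B₄`. -/

section Levels

variable {C₀ c₀ p : ℝ} {n m : ℕ}

theorem one_le_div_sqrt (hC₀ : 1 ≤ C₀) (h0 : 0 < p) (h1 : p ≤ 1) : 1 ≤ C₀ / Real.sqrt p := by
  rw [one_le_div (Real.sqrt_pos.2 h0)]
  exact (Real.sqrt_le_one.2 h1).trans hC₀

theorem beta_le_sqrt (hC₀ : 1 ≤ C₀) (p : ℝ) : beta C₀ p ≤ Real.sqrt p :=
  div_le_self (Real.sqrt_nonneg _) hC₀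

theorem beta_div_eq (hC₀ : 1 ≤ C₀) (h0 : 0 < p) (hn : 0 < n) :
    beta C₀ p / (6 * p * n) = 1 / (6 * C₀ * Real.sqrt p * n) := by
  have hn' : (0 : ℝ) < n := by exact_mod_cast hn
  have hs := Real.sqrt_pos.2 h0
  have e : p = Real.sqrt p * Real.sqrt p := (Real.mul_self_sqrt h0.le).symm
  unfold beta
  nth_rewrite 2 [e]
  field_simp

theorem one_div_le_one_div_six (hC₀ : 1 ≤ C₀) (h0 : 0 < p) (h1 : p ≤ 1) (hn : 0 < n) :
    1 / (6 * C₀ * Real.sqrt p * n) ≤ 1 / (6 * p * n) := by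
  have hn' : (0 : ℝ) < n := by exact_mod_cast hn
  have hs : p ≤ Real.sqrt p := Real.le_sqrt_of_sq_le (by nlinarith)
  have hs' : p ≤ C₀ * Real.sqrt p := by nlinarith
  apply one_div_le_one_div_of_le (by positivity)
  rw [mul_assoc 6 C₀]
  gcongr

theorem matP_B₂_le (hC₀ : 1 ≤ C₀) (hc₀ : 0 < c₀) (hc₀' : c₀ ≤ 1 / 10000) (hn : 2 ≤ n)
    (hm : 0 < m) (hmn : m ≤ n) (h0 : 0 < p) (h1 : p ≤ 1 / 20) (hpn : 1 ≤ p * n)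
    (hmc : (m : ℝ) ≤ sparsityConst C₀ * p * n / Real.log (Real.exp 1 / p)) :
    matP p (cubeBounded n p ∩
      {b | ∃ x ∈ B₂ C₀ c₀ n p m, ‖mv b x‖ < 1 / (480 * C₀ * Real.sqrt n)}) ≤
      10 ^ 18 * C₀ ^ 3 * n ^ 7 * Real.exp (-(1.8 * (p * n))) := by
  have hγ : 1 / (6 * C₀ * Real.sqrt p * n) ≤ 1 := by
    refine (one_div_le_one_div_six hC₀ h0 (by linarith) (by omega)).trans ?_
    rw [div_le_one (by linarith)]; linarith
  have hdiv := one_le_div_sqrt hC₀ h0 (by linarith)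
  have hsum : ∀ x ∈ B₂ C₀ c₀ n p m, ∑ i, x i ^ 2 = 1 := fun x hx => by
    have := EuclideanSpace.norm_sq_eq x
    rw [hx.1.1] at this
    simpa using this.symm
  -- Here `γ = 1`, and the whole vector has norm `1 ≤ 3C₀/√p`, so any index can serve as
  -- exceptional.
  refine matP_level_le hC₀ hc₀ hc₀' hm hmn h0 (by linarith) hmc hγ (fun x hx => hx.1.1.le)
    (fun x hx => by rw [mul_one]; exact hx.2) (fun x hx => ⟨⟨0, by omega⟩, ?_⟩) fun x hx => ?_
  · refine (Finset.sum_le_sum_of_subset_of_nonneg (Finset.subset_univ _)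
      fun _ _ _ => sq_nonneg _).trans ?_
    rw [hsum x hx, mul_div_assoc]
    nlinarith
  · obtain ⟨j, k, -, -, -, hle1, -⟩ := exists_top_two hn x
    refine matP_small_le_of_flat h0 h1 x Finset.univ one_pos (fun i _ => ?_) ?_
    · rw [mul_one]
      exact (hle1 i).trans (hx.1.2.2.trans (beta_le_sqrt hC₀ p))
    · rw [hsum x hx, one_pow]

theorem matP_B₃k_le (hC₀ : 1 ≤ C₀) (hc₀ : 0 < c₀) (hc₀' : c₀ ≤ 1 / 10000) (hn : 2 ≤ n)
    (hm : 0 < m) (hmn : m ≤ n) (h0 : 0 < p) (h1 : p ≤ 1 / 20) (hpn : 1 ≤ p * n)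
    (hmc : (m : ℝ) ≤ sparsityConst C₀ * p * n / Real.log (Real.exp 1 / p)) {k : ℕ} (hk : 1 ≤ k) :
    matP p (cubeBounded n p ∩
      {b | ∃ x ∈ B₃k C₀ c₀ n p m k, ‖mv b x‖ < 1 / (480 * C₀ * Real.sqrt n)}) ≤
      10 ^ 18 * C₀ ^ 3 * n ^ 7 * Real.exp (-(1.8 * (p * n))) := by
  have ha0 : 0 < 1 / (6 * p * n) := one_div_pos.2 (by linarith)
  have ha1 : 1 / (6 * p * n) ≤ 1 := by rw [div_le_one (by linarith)]; linarith
  have hγ0 : 0 < lam n p k := ladder_pos ha0 k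
  have hγ : 1 / (6 * C₀ * Real.sqrt p * n) ≤ lam n p k :=
    (one_div_le_one_div_six hC₀ h0 (by linarith) (by omega)).trans (le_ladder ha0 ha1 k)
  have hdiv := one_le_div_sqrt hC₀ h0 (by linarith)
  refine matP_level_le hC₀ hc₀ hc₀' hm hmn h0 (by linarith) hmc hγ (fun x hx => hx.1.1.le)
    (fun x hx => hx.2) (fun x hx => ?_) fun x hx => ?_
  · obtain ⟨j, _, -, -, -, -, -, hQ⟩ := exists_top_two hn x
    obtain ⟨-, -, -, -, hlt⟩ := hx.1
    refine ⟨j, ?_⟩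
    rw [← hQ]
    refine pow_le_pow_left₀ (norm_nonneg _) (hlt.le.trans ((ladder_succ_le hk).trans ?_)) 2
    rw [mul_div_assoc]
    change 3 * lam n p k ≤ _
    gcongr
    linarith
  · obtain ⟨j, _, -, -, -, -, hle2, hQ⟩ := exists_top_two hn x
    obtain ⟨-, -, hflat, hge, -⟩ := hx.1
    -- Flatness holds at scale `s = ‖Qx‖`, on all coordinates but the largest; since `λ_k ≤ ‖Qx‖`,
    -- the resulting event is the larger one.
    refine le_trans (matP_mono h0.le (by linarith) fun b hb => ?_)
      (matP_small_le_of_flat h0 h1 x (Finset.univ.erase j) (hγ0.trans_le hge) (fun i hi => ?_)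
        hQ.le)
    · refine le_trans (show ‖mv b x‖ ≤ 1 / 40 * lam n p k * Real.sqrt (p * n) from hb) ?_
      gcongr
    · refine (hle2 i (Finset.ne_of_mem_erase hi)).trans (hflat.trans ?_)
      exact mul_le_mul_of_nonneg_right (beta_le_sqrt hC₀ p) (norm_nonneg _)

theorem matP_B₄k_le (hC₀ : 1 ≤ C₀) (hc₀ : 0 < c₀) (hc₀' : c₀ ≤ 1 / 10000) (hn : 2 ≤ n)
    (hm : 0 < m) (hmn : m ≤ n) (h0 : 0 < p) (h1 : p ≤ 1 / 20) (hpn : 1 ≤ p * n)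
    (hmc : (m : ℝ) ≤ sparsityConst C₀ * p * n / Real.log (Real.exp 1 / p)) {k : ℕ} (hk : 1 ≤ k) :
    matP p (cubeBounded n p ∩
      {b | ∃ x ∈ B₄k C₀ c₀ n p m k, ‖mv b x‖ < 1 / (480 * C₀ * Real.sqrt n)}) ≤
      10 ^ 18 * C₀ ^ 3 * n ^ 7 * Real.exp (-(1.8 * (p * n))) := by
  have ha := beta_div_eq hC₀ h0 (show 0 < n by omega)
  have ha1 : beta C₀ p / (6 * p * n) ≤ 1 := by
    rw [ha]
    refine (one_div_le_one_div_six hC₀ h0 (by linarith) (by omega)).trans ?_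
    rw [div_le_one (by linarith)]; linarith
  have hsp := Real.sqrt_pos.2 h0
  have hβ : 0 < beta C₀ p := div_pos hsp (by linarith)
  have ha0 : 0 < beta C₀ p / (6 * p * n) := div_pos hβ (by linarith)
  have hγ0 : 0 < mu C₀ n p k := ladder_pos ha0 k
  have hγ : 1 / (6 * C₀ * Real.sqrt p * n) ≤ mu C₀ n p k := by
    rw [← ha]; exact le_ladder ha0 ha1 k
  have hL : 1 ≤ Real.sqrt (Real.log (Real.exp 1 / p)) :=
    Real.one_le_sqrt.2 (one_le_log_exp_one_div h0 (by linarith))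
  -- The factor `1/√ln(e/p)` in the flatness of `B₄` is simply discarded by `U_mono`.
  refine matP_level_le hC₀ hc₀ hc₀' hm hmn h0 (by linarith) hmc hγ (fun x hx => hx.1.1.le)
    (fun x hx => U_mono (div_le_self (by positivity) hL) hx.2) (fun x hx => ?_) fun x hx => ?_
  · obtain ⟨j, _, -, -, -, -, -, hQ⟩ := exists_top_two hn x
    obtain ⟨-, -, hsteep, -, hlt⟩ := hx.1
    refine ⟨j, ?_⟩
    rw [← hQ]
    refine pow_le_pow_left₀ (norm_nonneg _) ?_ 2
    -- This class dictates the tail constant `3C₀/√p = 3/β_p`: here `‖Qx‖` is bounded only through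
    -- `x₂*/β_p`.
    have h3 : beta C₀ p * ‖Q x‖ ≤ 3 * mu C₀ n p k :=
      hsteep.le.trans (hlt.le.trans (ladder_succ_le hk))
    rw [beta, div_mul_eq_mul_div, div_le_iff₀ (by linarith)] at h3
    rw [div_mul_eq_mul_div, le_div_iff₀ hsp]
    linarith
  · obtain ⟨j, l, hjl, hs1, hs2, hle1, -⟩ := exists_top_two hn x
    obtain ⟨-, -, -, hge, -⟩ := hx.1
    refine matP_small_le_of_two_large h0 h1 x hjl hγ0 ?_ (by rw [← hs2]; exact hge)
    rw [← hs1]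
    exact hge.trans (by rw [hs2]; exact hle1 l)

/-- The union bound over all classes and all rungs of the ladders. -/
theorem matP_B_le (hC₀ : 1 ≤ C₀) (hc₀ : 0 < c₀) (hc₀' : c₀ ≤ 1 / 10000) (hn : 2 ≤ n)
    (hm : 0 < m) (hmn : m ≤ n) (h0 : 0 < p) (h1 : p ≤ 1 / 20) (hpn : 1 ≤ p * n)
    (hmc : (m : ℝ) ≤ sparsityConst C₀ * p * n / Real.log (Real.exp 1 / p)) :
    matP p (cubeBounded n p ∩
      {b | ∃ x ∈ B₂ C₀ c₀ n p m ∪ B₃ C₀ c₀ n p m ∪ B₄ C₀ c₀ n p m,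
        ‖mv b x‖ < 1 / (480 * C₀ * Real.sqrt n)}) ≤
      10 ^ 20 * C₀ ^ 4 * n ^ 8 * Real.exp (-(1.8 * (p * n))) := by
  have hp1 : p ≤ 1 := by linarith
  have hn1 : (1 : ℝ) ≤ n := by exact_mod_cast (by omega : 1 ≤ n)
  set τ := 1 / (480 * C₀ * Real.sqrt n)
  set E := 10 ^ 18 * C₀ ^ 3 * n ^ 7 * Real.exp (-(1.8 * (p * n)))
  have hE : 0 ≤ E := by positivity
  -- Bounds the rungs of both ladders, whose inverse starting points are `6pn` and `6C₀√p n`.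
  set K : ℕ := ⌊6 * C₀ * n⌋₊
  have hK : (K : ℝ) ≤ 6 * C₀ * n := Nat.floor_le (by positivity)
  set I := Finset.Icc 1 K
  have hI : (I.card : ℝ) ≤ 6 * C₀ * n := by simpa [I] using hK
  have h2 : matP p (cubeBounded n p ∩ {b | ∃ x ∈ B₂ C₀ c₀ n p m, ‖mv b x‖ < τ}) ≤ E :=
    matP_B₂_le hC₀ hc₀ hc₀' hn hm hmn h0 h1 hpn hmc
  have h3 := matP_biUnion_le h0.le hp1 I (fun k => cubeBounded n p ∩
    {b | ∃ x ∈ B₃k C₀ c₀ n p m k, ‖mv b x‖ < τ}) fun k hk =>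
    matP_B₃k_le hC₀ hc₀ hc₀' hn hm hmn h0 h1 hpn hmc (Finset.mem_Icc.1 hk).1
  have h4 := matP_biUnion_le h0.le hp1 I (fun k => cubeBounded n p ∩
    {b | ∃ x ∈ B₄k C₀ c₀ n p m k, ‖mv b x‖ < τ}) fun k hk =>
    matP_B₄k_le hC₀ hc₀ hc₀' hn hm hmn h0 h1 hpn hmc (Finset.mem_Icc.1 hk).1
  have hs : Real.sqrt p ≤ 1 := Real.sqrt_le_one.2 hp1
  have hsub : cubeBounded n p ∩
      {b | ∃ x ∈ B₂ C₀ c₀ n p m ∪ B₃ C₀ c₀ n p m ∪ B₄ C₀ c₀ n p m, ‖mv b x‖ < τ} ⊆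
      (cubeBounded n p ∩ {b | ∃ x ∈ B₂ C₀ c₀ n p m, ‖mv b x‖ < τ}) ∪
      ((⋃ k ∈ I, cubeBounded n p ∩ {b | ∃ x ∈ B₃k C₀ c₀ n p m k, ‖mv b x‖ < τ}) ∪
      ⋃ k ∈ I, cubeBounded n p ∩ {b | ∃ x ∈ B₄k C₀ c₀ n p m k, ‖mv b x‖ < τ}) := by
    rintro b ⟨hb, x, (hx | ⟨k, hk, hk1, hx⟩) | ⟨k, hk, hk1, hx⟩, hlt⟩
    · exact Or.inl ⟨hb, x, hx, hlt⟩
    · refine Or.inr (Or.inl ?_)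
      simp only [Set.mem_iUnion]
      refine ⟨k, Finset.mem_Icc.2 ⟨hk, Nat.le_floor ?_⟩, hb, x, hx, hlt⟩
      have := le_inv_of_ladder_lt_one (one_div_pos.2 (by linarith)) hk hk1
      rw [one_div, inv_inv] at this
      refine this.trans ?_
      gcongr
      linarith
    · refine Or.inr (Or.inr ?_)
      simp only [Set.mem_iUnion]
      refine ⟨k, Finset.mem_Icc.2 ⟨hk, Nat.le_floor ?_⟩, hb, x, hx, hlt⟩
      have ha := beta_div_eq hC₀ h0 (show 0 < n by omega)
      have hsp := Real.sqrt_pos.2 h0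
      have := le_inv_of_ladder_lt_one (by rw [ha]; positivity) hk hk1
      rw [ha, one_div, inv_inv] at this
      refine this.trans ?_
      calc 6 * C₀ * Real.sqrt p * n ≤ 6 * C₀ * 1 * n := by gcongr
        _ = _ := by ring
  refine (matP_mono h0.le hp1 hsub).trans ((matP_union_le h0.le hp1 _ _).trans ?_)
  have h5 := matP_union_le h0.le hp1
    (⋃ k ∈ I, cubeBounded n p ∩ {b | ∃ x ∈ B₃k C₀ c₀ n p m k, ‖mv b x‖ < τ})
    (⋃ k ∈ I, cubeBounded n p ∩ {b | ∃ x ∈ B₄k C₀ c₀ n p m k, ‖mv b x‖ < τ})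
  have h6 : (I.card : ℝ) * E ≤ 6 * (C₀ * n * E) :=
    (mul_le_mul_of_nonneg_right hI hE).trans_eq (by ring)
  change _ ≤ (I.card : ℝ) * E at h3 h4
  have h7 : E ≤ C₀ * n * E :=
    le_mul_of_one_le_left hE (one_le_mul_of_one_le_of_one_le hC₀ hn1)
  have h8 : 10 ^ 20 * C₀ ^ 4 * n ^ 8 * Real.exp (-(1.8 * (p * n))) = 100 * (C₀ * n * E) := by
    simp only [E]; ring
  have h9 : 0 ≤ C₀ * n * E := by positivity
  rw [h8]
  linarith

end Levels

end SteepVectors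

/-! ### Assembly of the exceptional events. -/

theorem theorem5p1 :
    ∃ Cstar : ℝ, 1 ≤ Cstar ∧ ∀ C₀ : ℝ, Cstar ≤ C₀ →
    ∃ cstar : ℝ, 0 < cstar ∧ ∃ c C : ℝ, 0 < c ∧ 0 < C ∧ ∃ N : ℕ,
    ∀ c₀ : ℝ, 0 < c₀ → c₀ ≤ cstar →
    ∀ (n m : ℕ) (p : unitInterval), N ≤ n → 1 ≤ m → m ≤ n →
      (m : ℝ) ≤ c * p * n / Real.log (Real.exp 1 / p) →
      30 * Real.log n / n ≤ (p : ℝ) → (p : ℝ) < 1 / 20 →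
    ∀ (Ω : Type*) [MeasurableSpace Ω] (μ : Measure Ω) [IsProbabilityMeasure μ]
      (M : Ω → Matrix (Fin n) (Fin n) ℝ), SteepVectors.IsBernoulliMatrix μ p M →
      μ.real {ω | ∃ x ∈ SteepVectors.B C₀ c₀ n p m,
          ‖(WithLp.toLp 2 (Matrix.mulVec (M ω) x) : EuclideanSpace ℝ (Fin n))‖ <
            1 / (C * Real.sqrt (n * Real.log (Real.exp 1 / p))) * ‖x‖} ≤
        n * (1 - p) ^ n + 4 * Real.exp (-(1.5 * n * p)) := by
  open SteepVectors in
  -- `N` exceeds `10²⁰ C₀⁴`, so the constant in the union bound costs just one more factor `n`.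
  refine ⟨1, le_rfl, fun C₀ hC₀ => ⟨1 / 10000, by norm_num, sparsityConst C₀, 480 * C₀,
    sparsityConst_pos hC₀, by positivity, ⌈10 ^ 20 * C₀ ^ 4⌉₊ + 2, ?_⟩⟩
  intro c₀ hc₀ hc₀' n m p hN hm hmn hmc hp30 hp20 Ω _ μ _ M hM
  set q : ℝ := (p : ℝ)
  have hn : 2 ≤ n := by omega
  have hn2 : (2 : ℝ) ≤ n := by exact_mod_cast hn
  have hn' : (0 : ℝ) < n := by linarith
  have hnC : 10 ^ 20 * C₀ ^ 4 ≤ (n : ℝ) :=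
    (Nat.le_ceil _).trans (by exact_mod_cast (by omega : ⌈10 ^ 20 * C₀ ^ 4⌉₊ ≤ n))
  have hlog2 : 0.6931471803 < Real.log n :=
    Real.log_two_gt_d9.trans_le (Real.log_le_log (by norm_num) hn2)
  have hpn30 : 30 * Real.log n ≤ q * n := by rwa [div_le_iff₀ hn'] at hp30
  have h0 : 0 < q := by
    by_contra h
    nlinarith
  have h1 : q ≤ 1 / 20 := hp20.le
  have hq1 : q ≤ 1 := by linarith
  have hpn : 1 ≤ q * n := by linarith
  have hlogexp : (n : ℝ) = Real.exp (Real.log n) := (Real.exp_log hn').symm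
  have hL : 1 ≤ Real.log (Real.exp 1 / q) := one_le_log_exp_one_div h0 hq1
  have hsn := Real.sqrt_pos.2 hn'
  have hsL : Real.sqrt n ≤ Real.sqrt (n * Real.log (Real.exp 1 / q)) :=
    Real.sqrt_le_sqrt (by nlinarith)
  have hτ : 1 / (480 * C₀ * Real.sqrt (n * Real.log (Real.exp 1 / q))) ≤
      1 / (480 * C₀ * Real.sqrt n) := by gcongr
  refine (hM.measureReal_le fun A => ∃ x ∈ B C₀ c₀ n q m,
    ‖(WithLp.toLp 2 (Matrix.mulVec A x) : EuclideanSpace ℝ (Fin n))‖ <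
      1 / (480 * C₀ * Real.sqrt (n * Real.log (Real.exp 1 / q))) * ‖x‖).trans ?_
  simp only [mv_eq_mulVec]
  have hZ := matP_zero_column_le (n := n) h0.le hq1
  have hR := matP_large_row_le (n := n) h0.le hq1 (by
    nth_rewrite 1 [hlogexp]; exact Real.exp_le_exp.2 (by linarith))
  have hS := matP_signs_le (n := n) h0 hq1
  have hB := matP_B_le hC₀ hc₀ hc₀' hn hm hmn h0 h1 hpn hmc
  set Z := {b : Fin n → Fin n → Bool | ∃ j, ∀ i, b i j = false}
  set R := {b : Fin n → Fin n → Bool | ∃ i, 5 * (q * n) < ∑ j, bv (b i j)}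
  set S := {b : Fin n → Fin n → Bool | (∀ i, ∑ j, bv (b i j) ≤ 5 * (q * n)) ∧
      ∃ ε : Fin n → Bool, 648 * q * n ^ 2 < ∑ i, (∑ j, (bv (b i j) - q) * sg (ε j)) ^ 2}
  set T := cubeBounded n q ∩
      {b | ∃ x ∈ B₂ C₀ c₀ n q m ∪ B₃ C₀ c₀ n q m ∪ B₄ C₀ c₀ n q m,
        ‖mv b x‖ < 1 / (480 * C₀ * Real.sqrt n)}
  have hsub : {b : Fin n → Fin n → Bool | ∃ x ∈ B C₀ c₀ n q m, ‖mv b x‖ <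
      1 / (480 * C₀ * Real.sqrt (n * Real.log (Real.exp 1 / q))) * ‖x‖} ⊆
      Z ∪ (R ∪ (S ∪ T)) := by
    rintro b ⟨x, hx, hlt⟩
    by_cases hbZ : b ∈ Z
    · exact Or.inl hbZ
    by_cases hbR : b ∈ R
    · exact Or.inr (Or.inl hbR)
    by_cases hbS : b ∈ S
    · exact Or.inr (Or.inr (Or.inl hbS))
    refine Or.inr (Or.inr (Or.inr ?_))
    simp only [Z, Set.mem_ofPred_eq, not_exists, not_forall, Bool.not_eq_false] at hbZ
    simp only [R, Set.mem_ofPred_eq, not_exists, not_lt] at hbR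
    simp only [S, Set.mem_ofPred_eq, not_and, not_exists, not_lt] at hbS
    refine ⟨hbS hbR, ?_⟩
    have hx1 : ‖x‖ = 1 := by
      rcases hx with ((hx | hx) | ⟨k, -, -, hx⟩) | ⟨k, -, -, hx⟩
      · exact hx.1
      · exact hx.1.1
      · exact hx.1.1
      · exact hx.1.1
    rw [hx1, mul_one] at hlt
    have hlt' := hlt.trans_le hτ
    rcases hx with ((hx | hx) | hx) | hx
    · exfalso
      have h2 := norm_mv_ge_of_mem_B₁ hn hbZ hbR hx
      have h3 : 1 / (480 * C₀ * Real.sqrt n) ≤ 1 / (6 * Real.sqrt n) := by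
        gcongr; linarith
      linarith
    · exact ⟨x, Or.inl (Or.inl hx), hlt'⟩
    · exact ⟨x, Or.inl (Or.inr hx), hlt'⟩
    · exact ⟨x, Or.inr hx, hlt'⟩
  have hU := (matP_mono h0.le hq1 hsub).trans (matP_union_le h0.le hq1 _ _)
  have hU2 := matP_union_le h0.le hq1 R (S ∪ T)
  have hU3 := matP_union_le h0.le hq1 S T
  have hS' : Real.exp (-(n : ℝ)) ≤ Real.exp (-(1.5 * n * q)) :=
    Real.exp_le_exp.2 (by nlinarith)
  have hB' : 10 ^ 20 * C₀ ^ 4 * n ^ 8 * Real.exp (-(1.8 * (q * n))) ≤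
      Real.exp (-(1.5 * n * q)) := by
    calc 10 ^ 20 * C₀ ^ 4 * n ^ 8 * Real.exp (-(1.8 * (q * n)))
        ≤ n * n ^ 8 * Real.exp (-(1.8 * (q * n))) := by gcongr
      _ = (n : ℝ) ^ 9 * Real.exp (-(1.8 * (q * n))) := by ring
      _ = Real.exp (9 * Real.log n - 1.8 * (q * n)) := by
          nth_rewrite 1 [hlogexp]
          rw [← Real.exp_nat_mul, ← Real.exp_add]; push_cast; ring_nf
      -- Here `9 log n ≤ 0.3 qn`, which is exactly the hypothesis `qn ≥ 30 log n`.
      _ ≤ _ := Real.exp_le_exp.2 (by linarith)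
  have := Real.exp_pos (-(1.5 * n * q))
  linarith
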